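/- Let $G=(V,E)$ be a finite simple graph with at least one vertex, and let $k>0$ be an integer. An (oriented) separation of $G$ is a pair $(A,B)$ of subsets of $V$ with $A\cup B=V$ such that $G$ has no edge between $A\setminus B$ and $B\setminus A$; its inverse is $(B,A)$, its order is $|A\cap B|$, and $(A,B)\le(C,D)$ means $A\subseteq C$ and $B\supseteq D$. Let $\vec S_k$ be the set of all oriented separations of $G$ of order less than $k$, and $S_k$ the corresponding set of unoriented separations $\{(A,B),(B,A)\}$. An orientation of $S_k$ is a set $O\subseteq\vec S_k$ containing exactly one of $(A,B),(B,A)$ for each separation in $S_k$ (if $(A,B)=(B,A)$, this means that it contains $(A,B)$). It is consistent if there are no $r<s$ in $\vec S_k$, orienting distinct separations, such that both the inverse of $r$ and $s$ itself lie in $O$. It avoids a set $\mathcal F'$ of subsets of $\vec S_k$ if no subset of $O$ is an element of $\mathcal F'$; an $\mathcal F'$-tangle of $S_k$ is a consistent orientation of $S_k$ that avoids $\mathcal F'$. Let $$\mathcal F=\big\{\{(A_1,B_1),(A_2,B_2),(A_3,B_3)\}\subseteq\vec S_k : G[A_1]\cup G[A_2]\cup G[A_3]=G\big\},$$ where the three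 separations need not be distinct, and let $\mathcal F^*$ be the set of those $\sigma\in\mathcal F$ that are stars: $(A,B)\le(D,C)$ for all distinct $(A,B),(C,D)\in\sigma$. A tangle of order $k$ in $G$ is an orientation of $S_k$ that avoids $\mathcal F$. An $S_k$-tree over $\mathcal F^*$ is a pair $(T,\alpha)$ of a finite tree $T$ with at least one edge and a map $\alpha$ from the oriented edges $(x,y)$ of $T$ to $\vec S_k$ such that $\alpha(y,x)$ is always the inverse of $\alpha(x,y)$, and $\{\alpha(x,t): xt\in E(T)\}\in\mathcal F^*$ for every node $t$ of $T$. A branch-decomposition of $G$ is a finite tree $T$ all whose nodes have degree $1$ or $3$ together with a bijection from $E$ to the set of leaves of $T$; its width is the maximum, over the edges $e$ of $T$, of the number of vertices of $G$ that are incident both with an edge of $G$ mapped to one component of $T-e$ and with an edge of $G$ mapped to the other. The branch-width of $G$ is the least width of a branch-decomposition of $G$ if $|E|\ge 2$, and $0$ if $|E|\le 1$. **Theorem.** The following assertions are equivalent: 1. $G$ has a tangle of order $k$. 2. $G$ has an $\mathcal F$-tangle of $S_k$. 3. $G$ has an $\mathcal F^*$-tangle of $S_k$. 4. $G$ has no $S_k$-tree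 over $\mathcal F^*$. 5. $G$ has branch-width at least $k$; or $k\le 2$ and $G$ is a disjoint union of stars and isolated vertices and has at least one edge; or $k=1$ and $G$ has no edge. -/

import Mathlib

namespace TangleDuality

/-! ### Abstract separation systems -/

/-- A separation system: a partially ordered set with an order-reversing involution.
Its elements are the oriented separations. -/
class SepSystem (U : Type*) extends PartialOrder U where
  /-- The inverse of an oriented separation. -/
  inv : U → U
  inv_inv : ∀ s, inv (inv s) = s
  inv_le_inv : ∀ r s, r ≤ s → inv s ≤ inv r

section Abstract

variable {U : Type*} [SepSystem U]

/-- `O` is an orientation of (the set of separations whose orientations form) `S`: it is a subset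
of `S` that contains, for every `s ∈ S`, exactly one element of the set `{s, inv s}`
(which may be a singleton). -/
def IsOrientation (S O : Set U) : Prop :=
  O ⊆ S ∧ ∀ s ∈ S, ∃! x, x ∈ ({s, SepSystem.inv s} : Set U) ∧ x ∈ O

/-- `O` is consistent in `S`: there are no orientations `r < s` of distinct (unoriented)
separations in `S` such that `inv r` and `s` lie in `O`. -/
def IsConsistent (S O : Set U) : Prop :=
  ¬ ∃ r ∈ S, ∃ s ∈ S, ({r, SepSystem.inv r} : Set U) ≠ {s, SepSystem.inv s} ∧ r < s ∧
    SepSystem.inv r ∈ O ∧ s ∈ O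

/-- `O` avoids `F`: no subset of `O` is an element of `F`. -/
def Avoids (F : Set (Set U)) (O : Set U) : Prop :=
  ∀ σ ∈ F, ¬ σ ⊆ O

/-- An `F`-tangle of `S` is a consistent orientation of `S` that avoids `F`. -/
structure IsFTangle (S : Set U) (F : Set (Set U)) (O : Set U) : Prop where
  orientation : IsOrientation S O
  consistent : IsConsistent S O
  avoids : Avoids F O

/-- A star of separations: a non-empty set of oriented separations
that point towards each other. -/
def IsSepStar (σ : Set U) : Prop :=
  σ.Nonempty ∧ ∀ r ∈ σ, ∀ s ∈ σ, r ≠ s → r ≤ SepSystem.inv s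

/-- An `S`-tree: a finite tree with at least one edge, together with a map `α` from the set of its
oriented edges (`T.Dart`) to `S` that commutes with inversion. -/
structure STree (S : Set U) where
  Node : Type
  finite_node : Finite Node
  T : SimpleGraph Node
  isTree : T.IsTree
  nonempty_dart : Nonempty T.Dart
  α : T.Dart → U
  α_mem : ∀ e, α e ∈ S
  α_symm : ∀ e : T.Dart, α e.symm = SepSystem.inv (α e)

/-- The image under `α` of the oriented star at the node `t`, which consists of all oriented
edges `(x, t)` with head `t`. -/
def STree.starAt {S : Set U} (X : STree S) (t : X.Node) : Set U :=
  X.α '' {e | e.snd = t}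

/-- The `S`-tree is over `F`: for each of its nodes the associated set lies in `F`. -/
def STree.IsOver {S : Set U} (X : STree S) (F : Set (Set U)) : Prop :=
  ∀ t, X.starAt t ∈ F

end Abstract

/-! ### Vertex separations of graphs and tangles -/

section Graph

variable {V : Type*} (G : SimpleGraph V)

/-- An oriented vertex separation `(A, B)` of `G`: `A ∪ B` is the whole vertex set and `G` has
no edge between `A \ B` and `B \ A`. -/
@[ext] structure VSep where
  A : Set V
  B : Set V
  union_eq : A ∪ B = Set.univ
  no_edge : ∀ a ∈ A \ B, ∀ b ∈ B \ A, ¬ G.Adj a b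

variable {G}

/-- `(A, B) ≤ (C, D)` if and only if `A ⊆ C` and `B ⊇ D`. -/
instance : PartialOrder (VSep G) where
  le r s := r.A ⊆ s.A ∧ s.B ⊆ r.B
  le_refl _ := ⟨subset_rfl, subset_rfl⟩
  le_trans _ _ _ h h' := ⟨h.1.trans h'.1, h'.2.trans h.2⟩
  le_antisymm _ _ h h' := VSep.ext (h.1.antisymm h'.1) (h'.2.antisymm h.2)

/-- The inverse of `(A, B)` is `(B, A)`. -/
def VSep.flip (s : VSep G) : VSep G where
  A := s.B
  B := s.A
  union_eq := by rw [Set.union_comm, s.union_eq]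
  no_edge := fun a ha b hb h => s.no_edge b hb a ha h.symm

instance : SepSystem (VSep G) where
  inv := VSep.flip
  inv_inv _ := rfl
  inv_le_inv _ _ h := ⟨h.2, h.1⟩

/-- The order `|A ∩ B|` of a separation `(A, B)` (used for finite graphs only). -/
noncomputable def VSep.order (s : VSep G) : ℕ := (s.A ∩ s.B).ncard

variable (G)

/-- The set of all oriented separations of `G` of order less than `k`. -/
def sepsBelow (k : ℕ) : Set (VSep G) := {s | s.order < k}

/-- The set `F` of all sets `{(A₁, B₁), (A₂, B₂), (A₃, B₃)}` of not necessarily distinct oriented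
separations of order less than `k` such that `G[A₁] ∪ G[A₂] ∪ G[A₃] = G`. -/
def tangleF (k : ℕ) : Set (Set (VSep G)) :=
  {σ | ∃ s₁ ∈ sepsBelow G k, ∃ s₂ ∈ sepsBelow G k, ∃ s₃ ∈ sepsBelow G k, σ = {s₁, s₂, s₃} ∧
    (⊤ : G.Subgraph).induce s₁.A ⊔ (⊤ : G.Subgraph).induce s₂.A ⊔ (⊤ : G.Subgraph).induce s₃.A
      = ⊤}

/-- The set `F*` of those elements of `F` that are stars. -/
def tangleFStar (k : ℕ) : Set (Set (VSep G)) :=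
  {σ | σ ∈ tangleF G k ∧ IsSepStar σ}

/-- A tangle of order `k` in `G`: an orientation of the set of separations of order less than `k`
such that no three of its elements have first sides that together induce all of `G`. -/
def IsTangle (k : ℕ) (O : Set (VSep G)) : Prop :=
  IsOrientation (sepsBelow G k) O ∧ Avoids (tangleF G k) O

/-! ### Branch-width -/

/-- A branch-decomposition of `G`: a finite ternary tree `T` (each node has degree 1 or 3)
together with a bijection `L` from the edges of `G` to the leaves of `T`. -/
structure BranchDecomposition where
  Node : Type
  finite_node : Finite Node
  T : SimpleGraph Node
  isTree : T.IsTree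
  ternary : ∀ t, (T.neighborSet t).ncard = 1 ∨ (T.neighborSet t).ncard = 3
  L : G.edgeSet ≃ {t : Node // (T.neighborSet t).ncard = 1}

variable {G}

/-- The component of `T - e` that contains the initial node of the oriented edge `e`. -/
def BranchDecomposition.side (X : BranchDecomposition G) (e : X.T.Dart) : Set X.Node :=
  {t | (X.T.deleteEdges {e.edge}).Reachable e.fst t}

/-- The vertices of `G` that are incident with an edge mapped by `L` to the component of `T - e`
containing the initial node of `e`. -/
def BranchDecomposition.sideVerts (X : BranchDecomposition G) (e : X.T.Dart) : Set V :=
  {v | ∃ f : G.edgeSet, v ∈ f.1 ∧ (X.L f).1 ∈ X.side e}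

/-- The order of an edge of `T`: the number of vertices of `G` that are incident with edges of `G`
on both sides. -/
noncomputable def BranchDecomposition.edgeOrder (X : BranchDecomposition G) (e : X.T.Dart) : ℕ :=
  (X.sideVerts e ∩ X.sideVerts e.symm).ncard

/-- The width of a branch-decomposition: the maximum order of the edges of its tree. -/
noncomputable def BranchDecomposition.width (X : BranchDecomposition G) : ℕ :=
  ⨆ e : X.T.Dart, X.edgeOrder e

variable (G)

open Classical in
/-- The branch-width of a finite graph: the least width of its branch-decompositions if it has at
least two edges, and `0` otherwise. -/
noncomputable def branchWidth : ℕ :=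
  if G.edgeSet.ncard ≤ 1 then 0
  else sInf (Set.range (BranchDecomposition.width : BranchDecomposition G → ℕ))

/-- `G` is a disjoint union of stars and isolated vertices. An isolated vertex is a star graph
with one vertex. -/
def IsStarForest : Prop :=
  ∀ C : G.ConnectedComponent, ∃ c : C, C.toSimpleGraph = SimpleGraph.starGraph c

end Graph

end TangleDuality

namespace TangleDuality

/-! ### Vertex separations: lattice operations, submodularity, covering triples -/

section Separations

variable {V : Type*} {G : SimpleGraph V}

/-! The implications 1 → 2 → 3 are formal, since consistency is automatic. A tangle excludes a tree
by pigeonhole: a tree has fewer edges than nodes, so if every node selects an incoming edge whose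
label the orientation omits, some edge is selected from both ends (`exists_flip_of_adj`), and then
both orientations of one separation are missing.

The substance is 4 → 1. A star {x, y, z} in F* forces the inverse of x once y and z are chosen.
`Der` closes a set under such inferences, and a derivation of (V, ∅) from (∅, V) unfolds into an
S_k-tree over F* (`Der.exists_isOver`). If there is none, take a maximal down-closed P that contains
the small separations and does not derive (V, ∅). It orients every s: if s and its inverse were both
missing, minimal missing elements r below s and r' below the inverse of s would have derivable
inverses, by rerooting (`Der.reroot`). Shifting both derivations (`Der.shift`) to a separation x of
least order between r and the inverse of r' would derive both orientations of x, hence (V, ∅). P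
avoids all of F, not just F*, because covering triples can be uncrossed into nested ones
(`exists_nested_cover`).

For k ≥ 3, a derivation of (V, ∅) also builds E from single edges by disjoint unions with small
boundary, which is a branch-decomposition of width less than k (`Der.branched`). Conversely, a
tangle of order k and a branch-decomposition of width less than k contradict each other by the same
pigeonhole argument (`IsTangle.le_branchWidth`). For k ≤ 2, a vertex or an edge defines a tangle
directly, and graphs that are not star forests have branch-width at least two. -/

theorem VSep.mem_or (s : VSep G) (v : V) : v ∈ s.A ∨ v ∈ s.B := by
  have := s.union_eq ▸ Set.mem_univ v
  exact this

/-- Every edge lies in one of the two sides of a separation. -/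
theorem VSep.adj_cases (s : VSep G) {u v : V} (h : G.Adj u v) :
    (u ∈ s.A ∧ v ∈ s.A) ∨ (u ∈ s.B ∧ v ∈ s.B) := by
  by_contra hc
  rcases s.mem_or u with hu | hu <;> rcases s.mem_or v with hv | hv
  · exact hc (.inl ⟨hu, hv⟩)
  · exact s.no_edge u ⟨hu, fun h' => hc (.inr ⟨h', hv⟩)⟩ v ⟨hv, fun h' => hc (.inl ⟨hu, h'⟩)⟩ h
  · exact s.no_edge v ⟨hv, fun h' => hc (.inr ⟨hu, h'⟩)⟩ u ⟨hu, fun h' => hc (.inl ⟨h', hv⟩)⟩ h.symm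
  · exact hc (.inr ⟨hu, hv⟩)

/-- The separation with the given sides, for sides that together induce the whole graph. -/
def VSep.mk' (A B : Set V) (h : ∀ v, v ∈ A ∨ v ∈ B)
    (h' : ∀ u v, G.Adj u v → (u ∈ A ∧ v ∈ A) ∨ (u ∈ B ∧ v ∈ B)) : VSep G where
  A := A
  B := B
  union_eq := Set.eq_univ_of_forall h
  no_edge := fun a ha b hb hab => (h' a b hab).elim (fun h => hb.2 h.2) (fun h => ha.2 h.1)

/-- The infimum `(A ∩ A', B ∪ B')` of two separations. -/
def VSep.meet (r s : VSep G) : VSep G :=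
  VSep.mk' (r.A ∩ s.A) (r.B ∪ s.B)
    (fun v => by
      rcases r.mem_or v with h | h
      · rcases s.mem_or v with h' | h'
        · exact .inl ⟨h, h'⟩
        · exact .inr (.inr h')
      · exact .inr (.inl h))
    (fun u v huv => by
      rcases r.adj_cases huv with h | h
      · rcases s.adj_cases huv with h' | h'
        · exact .inl ⟨⟨h.1, h'.1⟩, ⟨h.2, h'.2⟩⟩
        · exact .inr ⟨.inr h'.1, .inr h'.2⟩
      · exact .inr ⟨.inl h.1, .inl h.2⟩)

/-- The supremum `(A ∪ A', B ∩ B')` of two separations. -/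
def VSep.join (r s : VSep G) : VSep G := (r.flip.meet s.flip).flip

theorem VSep.flip_flip (s : VSep G) : s.flip.flip = s := rfl

theorem VSep.flip_le_flip {r s : VSep G} : r.flip ≤ s.flip ↔ s ≤ r :=
  ⟨fun h => ⟨h.2, h.1⟩, fun h => ⟨h.2, h.1⟩⟩

theorem VSep.le_flip_comm {r s : VSep G} : r ≤ s.flip ↔ s ≤ r.flip :=
  ⟨fun h => ⟨h.2, h.1⟩, fun h => ⟨h.2, h.1⟩⟩

theorem VSep.meet_le_left (r s : VSep G) : r.meet s ≤ r :=
  ⟨Set.inter_subset_left, Set.subset_union_left⟩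

theorem VSep.meet_le_right (r s : VSep G) : r.meet s ≤ s :=
  ⟨Set.inter_subset_right, Set.subset_union_right⟩

theorem VSep.le_meet {q r s : VSep G} (h : q ≤ r) (h' : q ≤ s) : q ≤ r.meet s :=
  ⟨Set.subset_inter h.1 h'.1, Set.union_subset h.2 h'.2⟩

theorem VSep.meet_eq_right {r s : VSep G} (h : s ≤ r) : r.meet s = s :=
  le_antisymm (r.meet_le_right s) (VSep.le_meet h le_rfl)

theorem VSep.order_flip (s : VSep G) : s.flip.order = s.order := by
  unfold VSep.order
  rw [Set.inter_comm]
  rfl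

theorem VSep.flip_mem_sepsBelow {s : VSep G} {k : ℕ} :
    s.flip ∈ sepsBelow G k ↔ s ∈ sepsBelow G k := by
  simp only [sepsBelow, Set.mem_ofPred_eq, VSep.order_flip]

/-- Submodularity: the separators of the two corners have their union inside the union of the
original separators, and their intersection inside the intersection. -/
theorem VSep.order_meet_add_order_join_le [Finite V] (r s : VSep G) :
    (r.meet s).order + (r.join s).order ≤ r.order + s.order := by
  unfold VSep.order
  rw [← Set.ncard_union_add_ncard_inter (r.A ∩ r.B) (s.A ∩ s.B),
    ← Set.ncard_union_add_ncard_inter ((r.meet s).A ∩ (r.meet s).B)]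
  apply add_le_add <;> apply Set.ncard_le_ncard _ (Set.toFinite _)
  all_goals
    simp only [VSep.join, VSep.meet, VSep.mk', VSep.flip]
    intro v
    simp only [Set.mem_union, Set.mem_inter_iff]
    have h1 := r.mem_or v
    have h2 := s.mem_or v
    tauto

variable (G) in
/-- The least separation `(∅, V)`. -/
def VSep.least : VSep G :=
  VSep.mk' ∅ Set.univ (fun _ => .inr trivial) (fun _ _ _ => .inr ⟨trivial, trivial⟩)

theorem VSep.least_le (s : VSep G) : VSep.least G ≤ s :=
  ⟨Set.empty_subset _, Set.subset_univ _⟩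

theorem VSep.order_least : (VSep.least G).order = 0 := by
  simp [VSep.order, VSep.least, VSep.mk']

theorem VSep.least_mem {k : ℕ} (hk : 0 < k) : VSep.least G ∈ sepsBelow G k := by
  simpa [sepsBelow, VSep.order_least] using hk

instance [Finite V] : Finite (VSep G) :=
  Finite.of_injective (fun s : VSep G => (s.A, s.B)) fun r s h => by
    simp only [Prod.mk.injEq] at h
    exact VSep.ext h.1 h.2

/-- The first sides of three separations together induce the whole graph. -/
def Covers (r s t : VSep G) : Prop :=
  (∀ v, v ∈ r.A ∨ v ∈ s.A ∨ v ∈ t.A) ∧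
    ∀ u v, G.Adj u v → (u ∈ r.A ∧ v ∈ r.A) ∨ (u ∈ s.A ∧ v ∈ s.A) ∨ (u ∈ t.A ∧ v ∈ t.A)

theorem covers_iff {r s t : VSep G} : Covers r s t ↔
    (⊤ : G.Subgraph).induce r.A ⊔ (⊤ : G.Subgraph).induce s.A ⊔ (⊤ : G.Subgraph).induce t.A
      = ⊤ := by
  constructor
  · rintro ⟨h1, h2⟩
    ext u v
    · simpa [or_assoc] using h1 u
    · have := h2 u v
      simp only [SimpleGraph.Subgraph.sup_adj, SimpleGraph.Subgraph.induce_adj,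
        SimpleGraph.Subgraph.top_adj]
      tauto
  · intro h
    constructor
    · intro v
      have : v ∈ (⊤ : G.Subgraph).verts := trivial
      rw [← h] at this
      simpa [or_assoc] using this
    · intro u v huv
      have : (⊤ : G.Subgraph).Adj u v := huv
      rw [← h] at this
      simp only [SimpleGraph.Subgraph.sup_adj, SimpleGraph.Subgraph.induce_adj,
        SimpleGraph.Subgraph.top_adj] at this
      tauto

theorem mem_tangleF {k : ℕ} {r s t : VSep G} (hr : r ∈ sepsBelow G k) (hs : s ∈ sepsBelow G k)
    (ht : t ∈ sepsBelow G k) (h : Covers r s t) : {r, s, t} ∈ tangleF G k :=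
  ⟨r, hr, s, hs, t, ht, rfl, covers_iff.1 h⟩

theorem not_covers_of_avoids {k : ℕ} {O : Set (VSep G)} (hO : O ⊆ sepsBelow G k)
    (h : Avoids (tangleF G k) O) {r s t : VSep G} (hr : r ∈ O) (hs : s ∈ O) (ht : t ∈ O) :
    ¬ Covers r s t := fun hc =>
  h _ (mem_tangleF (hO hr) (hO hs) (hO ht) hc) (by
    rintro x (rfl | rfl | rfl) <;> assumption)

theorem avoids_tangleF_of {k : ℕ} {O : Set (VSep G)}
    (h : ∀ r ∈ O, ∀ s ∈ O, ∀ t ∈ O, ¬ Covers r s t) : Avoids (tangleF G k) O := by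
  rintro σ ⟨r, -, s, -, t, -, rfl, hc⟩ hσ
  exact h r (hσ (by simp)) s (hσ (by simp)) t (hσ (by simp)) (covers_iff.2 hc)

/-- A set containing exactly one of any two inverse separations of order less than `k`. -/
theorem isOrientation_iff {k : ℕ} {O : Set (VSep G)} :
    IsOrientation (sepsBelow G k) O ↔ O ⊆ sepsBelow G k ∧ ∀ s ∈ sepsBelow G k,
      (s ∈ O ∨ s.flip ∈ O) ∧ (s ∈ O → s.flip ∈ O → s = s.flip) := by
  refine and_congr_right fun _ => forall₂_congr fun s _ => ?_
  change (∃! x, (x = s ∨ x = s.flip) ∧ x ∈ O) ↔ _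
  constructor
  · rintro ⟨x, ⟨hx, hxO⟩, hu⟩
    refine ⟨?_, fun h1 h2 => (hu s ⟨.inl rfl, h1⟩).trans (hu _ ⟨.inr rfl, h2⟩).symm⟩
    rcases hx with rfl | rfl
    · exact .inl hxO
    · exact .inr hxO
  · rintro ⟨h1 | h1, h2⟩
    · refine ⟨s, ⟨.inl rfl, h1⟩, ?_⟩
      rintro y ⟨rfl | rfl, hy⟩
      · rfl
      · exact (h2 h1 hy).symm
    · refine ⟨s.flip, ⟨.inr rfl, h1⟩, ?_⟩
      rintro y ⟨rfl | rfl, hy⟩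
      · exact h2 hy h1
      · rfl

/-- An orientation that avoids `tangleF` contains exactly one of two inverse separations. -/
theorem IsTangle.mem_or {k : ℕ} {O : Set (VSep G)} (h : IsTangle G k O) {s : VSep G}
    (hs : s ∈ sepsBelow G k) : s ∈ O ∨ s.flip ∈ O :=
  ((isOrientation_iff.1 h.1).2 s hs).1

theorem IsTangle.subset {k : ℕ} {O : Set (VSep G)} (h : IsTangle G k O) : O ⊆ sepsBelow G k :=
  h.1.1

theorem IsTangle.not_covers {k : ℕ} {O : Set (VSep G)} (h : IsTangle G k O) {r s t : VSep G}
    (hr : r ∈ O) (hs : s ∈ O) (ht : t ∈ O) : ¬ Covers r s t :=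
  not_covers_of_avoids h.subset h.2 hr hs ht

/-- Otherwise the inverse of `r` lies in `O`, and together with `s` it covers the graph because `r.A
⊆ s.A`. Consistency of tangles rests on this. -/
theorem IsTangle.mem_of_le {k : ℕ} {O : Set (VSep G)} (h : IsTangle G k O) {r s : VSep G}
    (hs : s ∈ O) (hr : r ∈ sepsBelow G k) (hrs : r ≤ s) : r ∈ O := by
  refine (h.mem_or hr).resolve_right fun hr' => h.not_covers hs hr' hr' ⟨fun v => ?_, ?_⟩
  · exact (r.mem_or v).imp (fun h => hrs.1 h) .inl
  · exact fun u v huv => (r.adj_cases huv).imp (fun h => ⟨hrs.1 h.1, hrs.1 h.2⟩) .inl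

theorem IsTangle.isFTangle {k : ℕ} {O : Set (VSep G)} (h : IsTangle G k O) :
    IsFTangle (sepsBelow G k) (tangleF G k) O where
  orientation := h.1
  avoids := h.2
  consistent := by
    rintro ⟨r, hr, s, hs, -, hrs, hr', hs'⟩
    have hr0 := h.mem_of_le hs' hr hrs.le
    refine h.not_covers hr0 hr' hr' ⟨fun v => (r.mem_or v).imp id .inl, fun u v huv =>
      (r.adj_cases huv).imp id .inl⟩

end Separations

/-! ### Derivations of forced separations; a tangle when (V, ∅) is not derivable -/

section Derivations

variable {V : Type*} {G : SimpleGraph V} {k : ℕ}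

/-- The separations that must lie in every orientation which contains `P` and avoids
the stars in `tangleFStar G k`, witnessed by a derivation tree. -/
inductive Der (k : ℕ) (P : Set (VSep G)) : VSep G → Prop
  | base {r : VSep G} : r ∈ P → Der k P r
  | step {x y z : VSep G} : x ∈ sepsBelow G k → y ∈ sepsBelow G k → z ∈ sepsBelow G k →
      y ≤ x.flip → z ≤ x.flip → y ≤ z.flip → Covers x y z → Der k P y → Der k P z → Der k P x.flip

theorem Der.trans {P Q : Set (VSep G)} {r : VSep G} (h : Der k P r) (hPQ : ∀ s ∈ P, Der k Q s) :
    Der k Q r := by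
  induction h with
  | base h => exact hPQ _ h
  | step hx hy hz h1 h2 h3 h4 _ _ ih1 ih2 => exact .step hx hy hz h1 h2 h3 h4 ih1 ih2

theorem Der.mono {P Q : Set (VSep G)} {r : VSep G} (h : Der k P r) (hPQ : P ⊆ Q) : Der k Q r :=
  h.trans fun _ hs => .base (hPQ hs)

theorem Der.mem_sepsBelow {P : Set (VSep G)} (hP : P ⊆ sepsBelow G k) {r : VSep G}
    (h : Der k P r) : r ∈ sepsBelow G k := by
  cases h with
  | base h => exact hP h
  | step hx => exact VSep.flip_mem_sepsBelow.2 hx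

/-- Rotating a triple that covers the graph. -/
theorem Covers.rotate {r s t : VSep G} (h : Covers r s t) : Covers s t r :=
  ⟨fun v => by have := h.1 v; tauto, fun u v huv => by have := h.2 u v huv; tauto⟩

theorem Covers.swap {r s t : VSep G} (h : Covers r s t) : Covers s r t :=
  ⟨fun v => by have := h.1 v; tauto, fun u v huv => by have := h.2 u v huv; tauto⟩

/-- A separation is small if its second side contains all vertices. -/
def VSep.IsSmall (s : VSep G) : Prop := s.B = Set.univ

theorem VSep.IsSmall.of_le_flip {s : VSep G} (h : s ≤ s.flip) : s.IsSmall :=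
  Set.eq_univ_of_forall fun v => (s.mem_or v).elim (fun hv => h.1 hv) id

/-- Rerooting a derivation at a leaf labelled `r`. -/
theorem Der.reroot {P : Set (VSep G)} {r : VSep G}
    (hrs : ¬ r.IsSmall) {y : VSep G} (h : Der k (insert r P) y) :
    Der k P y ∨ (r ≤ y ∧ Der k (insert y.flip P) r.flip) := by
  induction h with
  | base h =>
    rcases h with rfl | h
    · exact .inr ⟨le_rfl, .base (.inl rfl)⟩
    · exact .inl (.base h)
  | @step x y z hx hy hz h1 h2 h3 h4 _ _ ih1 ih2 =>
    have key : ∀ y z : VSep G, y ∈ sepsBelow G k → z ∈ sepsBelow G k → y ≤ x.flip → z ≤ x.flip →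
        y ≤ z.flip → Covers x y z → r ≤ y → Der k (insert y.flip P) r.flip → Der k P z →
        r ≤ x.flip ∧ Der k (insert x.flip.flip P) r.flip := by
      intro y z hy hz h1 h2 h3 h4 hry hd hz'
      refine ⟨hry.trans h1, hd.trans ?_⟩
      rintro s (rfl | hs)
      -- The same star is read backwards: `x` and `z` now force the inverse of `y`.
      · exact .step hy hx hz (VSep.le_flip_comm.1 h1) (VSep.le_flip_comm.1 h3)
          (VSep.le_flip_comm.1 h2) h4.swap (.base (.inl rfl)) (hz'.mono (Set.subset_insert _ _))
      · exact .base (.inr hs)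
    rcases ih1 with ih1 | ⟨ih1, ih1'⟩ <;> rcases ih2 with ih2 | ⟨ih2, ih2'⟩
    · exact .inl (.step hx hy hz h1 h2 h3 h4 ih1 ih2)
    · exact .inr (key z y hz hy h2 h1 (VSep.le_flip_comm.1 h3) h4.rotate.rotate.swap
        ih2 ih2' ih1)
    · exact .inr (key y z hy hz h1 h2 h3 h4 ih1 ih1' ih2)
    -- Both premises cannot depend on `r`: then `r ≤ y ≤ z.flip ≤ r.flip`, which makes `r` small. So
    -- rerooting only ever follows a single branch.
    · exact absurd (VSep.IsSmall.of_le_flip ((ih1.trans h3).trans (VSep.flip_le_flip.2 ih2))) hrs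

/-- Shifting a derivation of a separation `≤ q` by `x`. -/
theorem Der.shift {P : Set (VSep G)}
    (hP : ∀ s ∈ P, ∀ r ∈ sepsBelow G k, r ≤ s → r ∈ P) {q x : VSep G}
    (hx : ∀ y ∈ sepsBelow G k, y ≤ q → y.meet x ∈ sepsBelow G k)
    (hPk : P ⊆ sepsBelow G k) {y : VSep G} (h : Der k P y) (hy : y ≤ q) : Der k P (y.meet x) := by
  induction h with
  | base h => exact .base (hP _ h _ (hx _ (hPk h) hy) (VSep.meet_le_left _ _))
  | @step z y y' hz hy1 hy2 h1 h2 h3 h4 _ _ ih1 ih2 =>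
    have hz' := hx _ (VSep.flip_mem_sepsBelow.2 hz) hy
    have m1 := hx _ hy1 (h1.trans hy)
    have m2 := hx _ hy2 (h2.trans hy)
    -- The two premises lose what lies outside `x.A`; the third member gains all of `x.B`, so the
    -- triple still covers.
    refine Der.step (x := (z.flip.meet x).flip) (VSep.flip_mem_sepsBelow.2 hz') m1 m2
      (VSep.le_meet ((VSep.meet_le_left _ _).trans h1) (VSep.meet_le_right _ _))
      (VSep.le_meet ((VSep.meet_le_left _ _).trans h2) (VSep.meet_le_right _ _))
      (((VSep.meet_le_left _ _).trans h3).trans (VSep.flip_le_flip.2 (VSep.meet_le_left _ _)))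
      ⟨fun v => ?_, fun u v huv => ?_⟩ (ih1 (h1.trans hy)) (ih2 (h2.trans hy))
    · rcases x.mem_or v with b | b
      · exact (h4.1 v).imp .inl (Or.imp (⟨·, b⟩) (⟨·, b⟩))
      · exact .inl (.inr b)
    · rcases x.adj_cases huv with ⟨b, b'⟩ | ⟨b, b'⟩
      · exact (h4.2 u v huv).imp (fun h => ⟨.inl h.1, .inl h.2⟩)
          (Or.imp (fun h => ⟨⟨h.1, b⟩, ⟨h.2, b'⟩⟩) (fun h => ⟨⟨h.1, b⟩, ⟨h.2, b'⟩⟩))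
      · exact .inl ⟨.inr b, .inr b'⟩

/-- Inverse derivable separations make the greatest separation derivable. -/
theorem Der.greatest {P : Set (VSep G)} (hk : 0 < k) (hP : P ⊆ sepsBelow G k) {s : VSep G}
    (h : Der k P s) (h' : Der k P s.flip) : Der k P (VSep.least G).flip :=
  .step (VSep.least_mem hk) (h.mem_sepsBelow hP) (h'.mem_sepsBelow hP)
    (VSep.le_flip_comm.1 (VSep.least_le _)) (VSep.le_flip_comm.1 (VSep.least_le _)) le_rfl
    ⟨fun v => .inr (s.mem_or v), fun _ _ huv => .inr (s.adj_cases huv)⟩ h h'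

theorem exists_minimal_notMem [Finite V] {P S : Set (VSep G)} {s : VSep G} (hs : s ∈ S)
    (hsP : s ∉ P) : ∃ r ∈ S, r ∉ P ∧ r ≤ s ∧ ∀ t ∈ S, t < r → t ∈ P := by
  have hne : {r | r ∈ S ∧ r ∉ P ∧ r ≤ s}.Nonempty := ⟨s, hs, hsP, le_rfl⟩
  obtain ⟨r, hr⟩ := (Set.toFinite {r | r ∈ S ∧ r ∉ P ∧ r ≤ s}).exists_minimal hne
  refine ⟨r, hr.prop.1, hr.prop.2.1, hr.prop.2.2, fun t ht htr => by_contra fun htP => ?_⟩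
  exact htr.not_ge (hr.le_of_le ⟨ht, htP, htr.le.trans hr.prop.2.2⟩ htr.le)

/-- Sets of separations that are closed downwards within `sepsBelow G k`, contain all small
separations and do not make the greatest separation derivable. -/
structure IsAdmissible (k : ℕ) (P : Set (VSep G)) : Prop where
  subset : P ⊆ sepsBelow G k
  down : ∀ s ∈ P, ∀ r ∈ sepsBelow G k, r ≤ s → r ∈ P
  small : ∀ s ∈ sepsBelow G k, s.IsSmall → s ∈ P
  not_der : ¬ Der k P (VSep.least G).flip

/-- Minimality of `r` keeps `insert r P` down-closed, so by maximality of `P` it must derive (V, ∅).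
Rerooting at `r` derives the inverse of `r` from `P` and (∅, V), and the latter is already in `P`.
-/
theorem IsAdmissible.der_flip {P : Set (VSep G)} (hP : Maximal (IsAdmissible k) P) (hk : 0 < k)
    {r : VSep G} (hr : r ∈ sepsBelow G k) (hrP : r ∉ P) (hm : ∀ t ∈ sepsBelow G k, t < r → t ∈ P) :
    Der k P r.flip := by
  have hrs : ¬ r.IsSmall := fun h => hrP (hP.prop.small r hr h)
  have hd : Der k (insert r P) (VSep.least G).flip := by
    by_contra hd
    refine hrP (hP.le_of_ge (y := insert r P) ⟨?_, ?_, ?_, hd⟩ (Set.subset_insert _ _)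
      (Set.mem_insert _ _))
    · exact Set.insert_subset hr hP.prop.subset
    · rintro s (rfl | hs) t ht hts
      · rcases hts.eq_or_lt with rfl | hts
        · exact .inl rfl
        · exact .inr (hm t ht hts)
      · exact .inr (hP.prop.down s hs t ht hts)
    · exact fun s hs hs' => .inr (hP.prop.small s hs hs')
  rcases hd.reroot hrs with h | ⟨-, h⟩
  · exact absurd h hP.prop.not_der
  · refine h.trans ?_
    rintro s (rfl | hs)
    · exact .base (hP.prop.small _ (VSep.least_mem hk) rfl)
    · exact .base hs

theorem IsAdmissible.mem_or [Finite V] {P : Set (VSep G)} (hP : Maximal (IsAdmissible k) P)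
    (hk : 0 < k) {s : VSep G} (hs : s ∈ sepsBelow G k) : s ∈ P ∨ s.flip ∈ P := by
  by_contra! hc
  obtain ⟨r, hr, hrP, hrs, hrm⟩ := exists_minimal_notMem hs hc.1
  obtain ⟨r', hr', hrP', hrs', hrm'⟩ :=
    exists_minimal_notMem (VSep.flip_mem_sepsBelow.2 hs) hc.2
  have hne : {x : VSep G | r ≤ x ∧ x ≤ r'.flip}.Nonempty := ⟨s, hrs, VSep.le_flip_comm.1 hrs'⟩
  obtain ⟨x, ⟨hrx, hxr⟩, hx⟩ := Set.exists_min_image _ VSep.order (Set.toFinite _) hne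
  have key : ∀ r r' x : VSep G, r ∈ sepsBelow G k → r ∉ P → (∀ t ∈ sepsBelow G k, t < r → t ∈ P) →
      r ≤ x → x ≤ r'.flip → (∀ y : VSep G, r ≤ y → y ≤ r'.flip → x.order ≤ y.order) →
      Der k P x.flip := by
    intro r r' x hr hrP hrm hrx hxr hx
    have hd := IsAdmissible.der_flip hP hk hr hrP hrm
    have := hd.shift hP.prop.down (q := r.flip) (x := x.flip) ?_ hP.prop.subset le_rfl
    · rwa [VSep.meet_eq_right (VSep.flip_le_flip.2 hrx)] at this
    · intro y hy hyr
      have h1 := VSep.order_meet_add_order_join_le y x.flip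
      -- This opposite corner again lies between `r` and `r'.flip`, so its order is at least that of
      -- `x`; submodularity then bounds the order of `y.meet x.flip` by that of `y`.
      have h2 := hx (y.join x.flip).flip (VSep.le_meet (VSep.le_flip_comm.1 hyr) hrx)
        ((VSep.meet_le_right _ _).trans hxr)
      rw [VSep.order_flip] at h1 h2
      have h3 : y.order < k := hy
      change _ < k
      omega
  have h1 := key r r' x hr hrP hrm hrx hxr fun y h1 h2 => hx y ⟨h1, h2⟩
  have h2 := key r' r x.flip hr' hrP' hrm' (VSep.le_flip_comm.1 hxr) (VSep.flip_le_flip.2 hrx)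
    fun y h1 h2 => by
      have := hx y.flip ⟨VSep.le_flip_comm.1 h2, VSep.flip_le_flip.2 h1⟩
      rwa [VSep.order_flip] at this ⊢
  exact hP.prop.not_der (h2.greatest hk hP.prop.subset h1)

/-- Uncrossing: a down-closed set of separations containing the first sides of a cover of the graph
contains one whose elements are nested. -/
theorem exists_nested_cover [Finite V] {P : Set (VSep G)} (hPk : P ⊆ sepsBelow G k)
    (hP : ∀ s ∈ P, ∀ r ∈ sepsBelow G k, r ≤ s → r ∈ P)
    (h : ∃ r ∈ P, ∃ s ∈ P, ∃ t ∈ P, Covers r s t) :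
    ∃ r ∈ P, ∃ s ∈ P, ∃ t ∈ P, Covers r s t ∧ r ≤ s.flip ∧ r ≤ t.flip ∧ s ≤ t.flip := by
  let C : Set (VSep G × VSep G × VSep G) :=
    {p | p.1 ∈ P ∧ p.2.1 ∈ P ∧ p.2.2 ∈ P ∧ Covers p.1 p.2.1 p.2.2}
  have hC : C.Nonempty := by
    obtain ⟨r, hr, s, hs, t, ht, hc⟩ := h
    exact ⟨(r, s, t), hr, hs, ht, hc⟩
  obtain ⟨⟨r, s, t⟩, hm⟩ := (Set.toFinite C).exists_minimal hC
  obtain ⟨hr, hs, ht, hc⟩ := hm.prop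
  dsimp only at hr hs ht hc
  have hmin : ∀ r' s' t' : VSep G, r' ∈ P → s' ∈ P → t' ∈ P → Covers r' s' t' → r' ≤ r → s' ≤ s →
      t' ≤ t → r ≤ r' ∧ s ≤ s' ∧ t ≤ t' := fun r' s' t' h1 h2 h3 h4 h5 h6 h7 =>
    hm.le_of_le (y := (r', s', t')) ⟨h1, h2, h3, h4⟩ ⟨h5, h6, h7⟩
  have cross : ∀ {a b c : VSep G}, Covers a b c → Covers (a.meet b.flip) b c := by
    intro a b c hc
    refine ⟨fun v => ?_, fun u v huv => ?_⟩
    · have h1 := hc.1 v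
      have h2 := b.mem_or v
      simp only [VSep.meet, VSep.mk', VSep.flip, Set.mem_inter_iff]
      tauto
    · have h1 := hc.2 u v huv
      have h2 := b.adj_cases huv
      simp only [VSep.meet, VSep.mk', VSep.flip, Set.mem_inter_iff]
      tauto
  -- The orders of the two corners add up to at most `a.order + b.order`, so one of them is no
  -- larger than the order of the separation above it.
  have small : ∀ a ∈ P, ∀ b ∈ P, a.meet b.flip ∈ P ∨ b.meet a.flip ∈ P := by
    intro a ha b hb
    have h1 := VSep.order_meet_add_order_join_le a b.flip
    have h2 : a.order < k := hPk ha
    have h3 : b.order < k := hPk hb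
    have h4 : (a.join b.flip).order = (b.meet a.flip).order := by
      rw [VSep.join, VSep.order_flip]
      congr 1
      ext v
      · exact and_comm
      · exact or_comm
    rw [VSep.order_flip] at h1
    rcases le_or_gt (a.meet b.flip).order a.order with h | h
    · exact .inl (hP a ha _ (h.trans_lt h2) (VSep.meet_le_left _ _))
    · exact .inr (hP b hb _ (by change _ < k; omega) (VSep.meet_le_left _ _))
  -- Each replacement by a corner still covers, so minimality of the triple forces it to change
  -- nothing, and that is nestedness.
  refine ⟨r, hr, s, hs, t, ht, hc, ?_, ?_, ?_⟩
  · rcases small r hr s hs with h | h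
    · exact (hmin _ s t h hs ht (cross hc) (VSep.meet_le_left _ _) le_rfl le_rfl).1.trans
        (VSep.meet_le_right _ _)
    · exact VSep.le_flip_comm.1 ((hmin r _ t hr h ht (cross hc.swap).swap le_rfl
        (VSep.meet_le_left _ _) le_rfl).2.1.trans (VSep.meet_le_right _ _))
  · rcases small r hr t ht with h | h
    · exact (hmin _ s t h hs ht (cross hc.rotate.rotate.swap).swap.rotate
        (VSep.meet_le_left _ _) le_rfl le_rfl).1.trans (VSep.meet_le_right _ _)
    · exact VSep.le_flip_comm.1 ((hmin r s _ hr hs h (cross hc.rotate.rotate).rotate le_rfl le_rfl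
        (VSep.meet_le_left _ _)).2.2.trans (VSep.meet_le_right _ _))
  · rcases small s hs t ht with h | h
    · exact (hmin r _ t hr h ht (cross hc.rotate).rotate.rotate le_rfl (VSep.meet_le_left _ _)
        le_rfl).2.1.trans (VSep.meet_le_right _ _)
    · exact VSep.le_flip_comm.1 ((hmin r s _ hr hs h (cross hc.rotate.swap).swap.rotate.rotate
        le_rfl le_rfl (VSep.meet_le_left _ _)).2.2.trans (VSep.meet_le_right _ _))

/-- A graph without a tangle of order `k` has a derivation of the greatest separation. -/
theorem der_of_forall_not_isTangle [Finite V] (hk : 0 < k) (h : ¬ ∃ O, IsTangle G k O) :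
    Der k {VSep.least G} (VSep.least G).flip := by
  by_contra hd
  have hlk : {VSep.least G} ⊆ sepsBelow G k := Set.singleton_subset_iff.2 (VSep.least_mem hk)
  have h0 : IsAdmissible k {s : VSep G | s ∈ sepsBelow G k ∧ s.IsSmall} := by
    refine ⟨fun s hs => hs.1, ?_, fun s hs hs' => ⟨hs, hs'⟩, fun hd' => hd (hd'.trans ?_)⟩
    · rintro s ⟨hs, hs'⟩ r hr hrs
      exact ⟨hr, Set.eq_univ_of_univ_subset (hs' ▸ hrs.2)⟩
    -- The inverse of a small separation covers the graph alone, so one step from two copies of (∅,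
    -- V) derives `s`.
    · rintro s ⟨hs, hs'⟩
      have hs0 : ∀ v, v ∈ s.B := fun v => hs' ▸ Set.mem_univ v
      exact .step (x := s.flip) (VSep.flip_mem_sepsBelow.2 hs) (VSep.least_mem hk)
        (VSep.least_mem hk) (VSep.least_le _) (VSep.least_le _) (VSep.least_le _)
        ⟨fun v => .inl (hs0 v), fun u v _ => .inl ⟨hs0 u, hs0 v⟩⟩ (.base rfl) (.base rfl)
  obtain ⟨P, -, hP⟩ := (Set.toFinite {P : Set (VSep G) | IsAdmissible k P}).exists_le_maximal h0
  refine h ⟨P, isOrientation_iff.2 ⟨hP.prop.subset, fun s hs =>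
    ⟨IsAdmissible.mem_or hP hk hs, fun h1 h2 => ?_⟩⟩, avoids_tangleF_of ?_⟩
  · exact absurd (Der.greatest hk hP.prop.subset (.base h1) (.base h2)) hP.prop.not_der
  · intro r hr s hs t ht hc
    obtain ⟨r, hr, s, hs, t, ht, hc, h1, h2, h3⟩ :=
      exists_nested_cover hP.prop.subset hP.prop.down ⟨r, hr, s, hs, t, ht, hc⟩
    have := Der.step (hP.prop.subset ht) (hP.prop.subset hr) (hP.prop.subset hs) h2 h3 h1
      hc.rotate.rotate (.base hr) (.base hs)
    exact hP.prop.not_der (Der.greatest hk hP.prop.subset (.base ht) this)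

end Derivations

/-! ### Gluing labelled trees along an edge, and a pigeonhole lemma for trees -/

section LabelledTrees

/-- A finite tree whose oriented edges are labelled by elements of `S`, so that reversing an edge
applies `inv` to its label. -/
structure LTree {Λ : Type*} (inv : Λ → Λ) (S : Set Λ) where
  Node : Type
  [fintype_node : Fintype Node]
  T : SimpleGraph Node
  isTree : T.IsTree
  α : Node → Node → Λ
  α_mem : ∀ x y, T.Adj x y → α x y ∈ S
  α_symm : ∀ x y, T.Adj x y → α y x = inv (α x y)

attribute [instance] LTree.fintype_node

variable {Λ : Type*} {inv : Λ → Λ} {S : Set Λ}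

open Classical in
/-- The multiset of the labels of the edges towards `t`. -/
noncomputable def LTree.incoming (X : LTree inv S) (t : X.Node) : Multiset Λ :=
  ∑ x, if X.T.Adj x t then {X.α x t} else 0

theorem LTree.mem_incoming (X : LTree inv S) (t : X.Node) (l : Λ) :
    l ∈ X.incoming t ↔ ∃ x, X.T.Adj x t ∧ X.α x t = l := by
  simp only [LTree.incoming, Multiset.mem_sum, Finset.mem_univ, true_and]
  refine exists_congr fun x => ?_
  split_ifs with h <;> simp [h, eq_comm]

theorem LTree.card_incoming (X : LTree inv S) (t : X.Node) :
    (X.incoming t).card = (X.T.neighborSet t).ncard := by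
  classical
  rw [LTree.incoming, Multiset.card_sum, Set.ncard_eq_toFinset_card']
  simp only [apply_ite Multiset.card, Multiset.card_singleton, Multiset.card_zero,
    Finset.sum_boole, Nat.cast_id]
  congr 1
  ext x
  simp [X.T.adj_comm]

theorem LTree.exists_incoming_eq (X : LTree inv S) {t x y : X.Node} (hx : X.T.Adj x t)
    (hy : X.T.Adj y t) (hxy : x ≠ y) : ∃ M, X.incoming t = X.α x t ::ₘ X.α y t ::ₘ M := by
  classical
  refine ⟨∑ z ∈ (Finset.univ.erase x).erase y, if X.T.Adj z t then {X.α z t} else 0, ?_⟩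
  rw [LTree.incoming, ← Finset.add_sum_erase _ _ (Finset.mem_univ x),
    ← Finset.add_sum_erase _ _ (Finset.mem_erase.2 ⟨hxy.symm, Finset.mem_univ y⟩), if_pos hx,
    if_pos hy, Multiset.singleton_add, Multiset.singleton_add]

/-- There is a labelled tree with a node whose incoming labels are `M`, such that at all other
nodes the incoming labels form an element of `𝓜`. -/
def HasLTree (inv : Λ → Λ) (S : Set Λ) (𝓜 : Set (Multiset Λ)) (M : Multiset Λ) : Prop :=
  ∃ (X : LTree inv S) (ρ : X.Node), X.incoming ρ = M ∧ ∀ t, t ≠ ρ → X.incoming t ∈ 𝓜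

theorem HasLTree.zero [Nonempty Λ] (𝓜 : Set (Multiset Λ)) : HasLTree inv S 𝓜 0 :=
  ⟨{ Node := Unit, T := ⊥, isTree := .of_subsingleton, α := fun _ _ => Classical.arbitrary Λ
     α_mem := fun _ _ h => h.elim, α_symm := fun _ _ h => h.elim },
    (), by simp [LTree.incoming], fun _ ht => absurd rfl ht⟩

/-- The disjoint sum of two graphs with an additional edge. -/
def joinGraph {M N : Type*} (T : SimpleGraph M) (T' : SimpleGraph N) (a : M) (b : N) :
    SimpleGraph (M ⊕ N) where
  Adj
    | .inl x, .inl y => T.Adj x y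
    | .inr x, .inr y => T'.Adj x y
    | .inl x, .inr y => x = a ∧ y = b
    | .inr y, .inl x => x = a ∧ y = b
  symm.symm
    | .inl _, .inl _ => T.adj_symm
    | .inr _, .inr _ => T'.adj_symm
    | .inl _, .inr _ => id
    | .inr _, .inl _ => id
  loopless.irrefl
    | .inl _ => T.irrefl
    | .inr _ => T'.irrefl

theorem joinGraph_isTree {M N : Type*} [Finite M] [Finite N] {T : SimpleGraph M}
    {T' : SimpleGraph N} (hT : T.IsTree) (hT' : T'.IsTree) (a : M) (b : N) :
    (joinGraph T T' a b).IsTree := by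
  let f : T →g joinGraph T T' a b := ⟨Sum.inl, fun h => h⟩
  let f' : T' →g joinGraph T T' a b := ⟨Sum.inr, fun h => h⟩
  have hab : (joinGraph T T' a b).Adj (.inl a) (.inr b) := ⟨rfl, rfl⟩
  have hreach : ∀ x, (joinGraph T T' a b).Reachable (.inl a) x := by
    rintro (x | x)
    · exact (hT.connected.preconnected a x).map f
    · exact hab.reachable.trans ((hT'.connected.preconnected b x).map f')
  have hconn : (joinGraph T T' a b).Connected :=
    { preconnected := fun x y => (hreach x).symm.trans (hreach y), nonempty := ⟨.inl a⟩ }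
  rw [SimpleGraph.isTree_iff_connected_and_card] at hT hT' ⊢
  refine ⟨hconn, le_antisymm ?_ hconn.card_vert_le_card_edgeSet_add_one⟩
  have hsub : (joinGraph T T' a b).edgeSet ⊆
      insert s(.inl a, .inr b) (Sym2.map Sum.inl '' T.edgeSet ∪ Sym2.map Sum.inr '' T'.edgeSet) := by
    intro e
    induction e with | _ x y
    intro h
    rcases x with x | x <;> rcases y with y | y
    · exact .inr (.inl ⟨s(x, y), h, rfl⟩)
    · obtain ⟨rfl, rfl⟩ := h
      exact .inl rfl
    · obtain ⟨rfl, rfl⟩ := h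
      exact .inl Sym2.eq_swap
    · exact .inr (.inr ⟨s(x, y), h, rfl⟩)
  have h1 := Set.ncard_le_ncard hsub (Set.toFinite _)
  have h2 := Set.ncard_insert_le s(Sum.inl a, Sum.inr b)
    (Sym2.map Sum.inl '' T.edgeSet ∪ Sym2.map Sum.inr '' T'.edgeSet)
  have h3 := Set.ncard_union_le (Sym2.map (Sum.inl (β := N)) '' T.edgeSet)
    (Sym2.map (Sum.inr (α := M)) '' T'.edgeSet)
  have h4 := Set.ncard_image_le (f := Sym2.map (Sum.inl (β := N))) (Set.toFinite T.edgeSet)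
  have h5 := Set.ncard_image_le (f := Sym2.map (Sum.inr (α := M))) (Set.toFinite T'.edgeSet)
  have h6 := hT.2
  have h7 := hT'.2
  rw [Nat.card_sum]
  rw [Nat.card_coe_set_eq] at h6 h7 ⊢
  omega

/-- Joining the roots of two labelled trees by an edge labelled `l`. -/
theorem HasLTree.join {𝓜 : Set (Multiset Λ)} {M M' : Multiset Λ} (h : HasLTree inv S 𝓜 M)
    (h' : HasLTree inv S 𝓜 M') {l : Λ} (hl : l ∈ S) (hl' : inv l ∈ S) (hll : inv (inv l) = l)
    (hM' : inv l ::ₘ M' ∈ 𝓜) : HasLTree inv S 𝓜 (l ::ₘ M) := by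
  classical
  obtain ⟨X, a, rfl, hX⟩ := h
  obtain ⟨Y, b, rfl, hY⟩ := h'
  let Z : LTree inv S :=
    { Node := X.Node ⊕ Y.Node
      T := joinGraph X.T Y.T a b
      isTree := joinGraph_isTree X.isTree Y.isTree a b
      α := fun x y => match x, y with
        | .inl x, .inl y => X.α x y
        | .inr x, .inr y => Y.α x y
        | .inl _, .inr _ => inv l
        | .inr _, .inl _ => l
      α_mem := by
        rintro (x | x) (y | y) h
        exacts [X.α_mem x y h, hl', hl, Y.α_mem x y h]
      α_symm := by
        rintro (x | x) (y | y) h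
        exacts [X.α_symm x y h, hll.symm, rfl, Y.α_symm x y h] }
  have hZl : ∀ t, Z.incoming (.inl t) = X.incoming t + if t = a then {l} else 0 := by
    intro t
    refine (Fintype.sum_sum_type _).trans (congrArg₂ _ rfl ?_)
    refine (Finset.sum_congr rfl fun x _ => ?_).trans (Fintype.sum_ite_eq' b fun _ => _)
    by_cases hx : x = b <;> by_cases ht : t = a <;> simp [Z, joinGraph, hx, ht]
  have hZr : ∀ t, Z.incoming (.inr t) = (if t = b then {inv l} else 0) + Y.incoming t := by
    intro t
    refine (Fintype.sum_sum_type _).trans (congrArg₂ _ ?_ rfl)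
    refine (Finset.sum_congr rfl fun x _ => ?_).trans (Fintype.sum_ite_eq' a fun _ => _)
    by_cases hx : x = a <;> by_cases ht : t = b <;> simp [Z, joinGraph, hx, ht]
  refine ⟨Z, .inl a, ?_, ?_⟩
  · rw [hZl, if_pos rfl, add_comm, Multiset.singleton_add]
  · rintro (t | t) ht
    · have : t ≠ a := fun h => ht (by rw [h])
      rw [hZl, if_neg this, add_zero]
      exact hX t this
    · rw [hZr]
      split_ifs with h
      · rwa [h, Multiset.singleton_add]
      · rw [zero_add]
        exact hY t h

end LabelledTrees

/-- A map that sends every node of a finite tree to a neighbour flips some edge. -/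
theorem exists_flip_of_adj {N : Type*} [Finite N] {T : SimpleGraph N} (hT : T.IsTree) (f : N → N)
    (hf : ∀ t, T.Adj t (f t)) : ∃ t, f (f t) = t := by
  classical
  have := Fintype.ofFinite N
  have hcard := hT.card_edgeFinset
  obtain ⟨x, -, y, -, hxy, h⟩ := Finset.exists_ne_map_eq_of_card_lt_of_maps_to
    (s := Finset.univ) (t := T.edgeFinset) (f := fun t => s(t, f t))
    (by rw [Finset.card_univ]; omega) (fun t _ => by simpa using hf t)
  rcases Sym2.eq_iff.1 h with ⟨h, -⟩ | ⟨h, h'⟩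
  · exact absurd h hxy
  · exact ⟨x, by rw [h', ← h]⟩

/-! ### Trees over stars: excluded by tangles, produced by derivations -/

section STrees

variable {V : Type*} {G : SimpleGraph V} {k : ℕ}

/-- A tangle that avoids stars excludes trees over these stars. -/
theorem not_exists_isOver_of_isFTangle {F : Set (Set (VSep G))} {O : Set (VSep G)}
    (hO : IsFTangle (sepsBelow G k) F O) : ¬ ∃ X : STree (sepsBelow G k), X.IsOver F := by
  rintro ⟨X, hX⟩
  have := X.finite_node
  have hex : ∀ t, ∃ u, ∃ h : X.T.Adj u t, X.α ⟨(u, t), h⟩ ∉ O := by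
    intro t
    by_contra! hc
    refine hO.avoids _ (hX t) ?_
    rintro _ ⟨⟨⟨u, t'⟩, h⟩, rfl, rfl⟩
    exact hc u h
  choose f hf hfO using hex
  obtain ⟨t, ht⟩ := exists_flip_of_adj X.isTree f fun t => (hf t).symm
  have h1 := hfO t
  have h2 := hfO (f t)
  simp only [ht] at h2
  have h3 : X.α ⟨(t, f t), (hf t).symm⟩ = (X.α ⟨(f t, t), hf t⟩).flip := X.α_symm ⟨(f t, t), hf t⟩
  rw [h3] at h2
  rcases ((isOrientation_iff.1 hO.orientation).2 _ (X.α_mem ⟨(f t, t), hf t⟩)).1 with h | h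
  exacts [h1 h, h2 h]

instance : Nonempty (VSep G) := ⟨VSep.least G⟩

/-- A derivation yields a tree in which one edge leads to nowhere. -/
theorem Der.exists_hasLTree (hk : 0 < k) {r : VSep G} (h : Der k {VSep.least G} r) :
    ∃ M, HasLTree VSep.flip (sepsBelow G k) {M | {s | s ∈ M} ∈ tangleFStar G k} M ∧
      {s | s ∈ r.flip ::ₘ M} ∈ tangleFStar G k := by
  induction h with
  | base h =>
    obtain rfl := h
    refine ⟨0, .zero _, ?_⟩
    have : {s | s ∈ (VSep.least G).flip ::ₘ 0} = {(VSep.least G).flip} := by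
      ext; simp
    rw [this]
    refine ⟨?_, Set.singleton_nonempty _, by rintro _ rfl _ rfl h; exact absurd rfl h⟩
    have h0 := VSep.flip_mem_sepsBelow.2 (VSep.least_mem (G := G) hk)
    simpa using mem_tangleF h0 h0 h0 ⟨fun _ => .inl trivial, fun _ _ _ => .inl ⟨trivial, trivial⟩⟩
  | @step x y z hx hy hz h1 h2 h3 h4 _ _ ih1 ih2 =>
    obtain ⟨M, hM, hM'⟩ := ih1
    obtain ⟨N, hN, hN'⟩ := ih2
    -- The new root receives only `y` and `z`; its third edge, labelled `x`, stays open for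
    -- attaching the tree to the next step.
    refine ⟨y ::ₘ z ::ₘ 0, ((HasLTree.zero _).join hN hz (VSep.flip_mem_sepsBelow.2 hz) rfl
      hN').join hM hy (VSep.flip_mem_sepsBelow.2 hy) rfl hM', ?_⟩
    have : {s | s ∈ x.flip.flip ::ₘ y ::ₘ z ::ₘ 0} = {x, y, z} := by
      ext; simp [VSep.flip_flip]
    rw [this]
    refine ⟨mem_tangleF hx hy hz h4, ⟨x, by simp⟩, ?_⟩
    have h1' := VSep.le_flip_comm.1 h1
    have h2' := VSep.le_flip_comm.1 h2
    have h3' := VSep.le_flip_comm.1 h3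
    rintro r (rfl | rfl | rfl) s (rfl | rfl | rfl) hrs <;> first | exact absurd rfl hrs | assumption

/-- If the greatest separation is derivable, there is a tree over `tangleFStar G k`. -/
theorem Der.exists_isOver (hk : 0 < k) (h : Der k {VSep.least G} (VSep.least G).flip) :
    ∃ X : STree (sepsBelow G k), X.IsOver (tangleFStar G k) := by
  obtain ⟨M, hM, hM'⟩ := h.exists_hasLTree hk
  -- A single node, completed by the star {(V, ∅)}, closes the last open edge.
  obtain ⟨N, hN, hN'⟩ := (Der.base (k := k) (Set.mem_singleton (VSep.least G))).exists_hasLTree hk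
  have h0 : (VSep.least G).flip ∈ sepsBelow G k := VSep.flip_mem_sepsBelow.2 (VSep.least_mem hk)
  obtain ⟨X, ρ, hρ, hX⟩ := hN.join hM h0 (VSep.least_mem hk) rfl hM'
  have hall : ∀ t, {s | s ∈ X.incoming t} ∈ tangleFStar G k := by
    intro t
    by_cases ht : t = ρ
    · rw [ht, hρ]
      exact hN'
    · exact hX t ht
  have hstar : ∀ t : X.Node, (fun e : X.T.Dart => X.α e.fst e.snd) '' {e | e.snd = t} =
      {s | s ∈ X.incoming t} := by
    intro t
    ext s
    rw [Set.mem_ofPred_eq, X.mem_incoming]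
    constructor
    · rintro ⟨e, rfl, rfl⟩
      exact ⟨e.fst, e.adj, rfl⟩
    · rintro ⟨x, hx, rfl⟩
      exact ⟨⟨(x, t), hx⟩, rfl, rfl⟩
  refine ⟨{ Node := X.Node, finite_node := inferInstance, T := X.T, isTree := X.isTree
            nonempty_dart := ?_
            α := fun e => X.α e.fst e.snd
            α_mem := fun e => X.α_mem _ _ e.adj
            α_symm := fun e => X.α_symm _ _ e.adj }, fun t => ?_⟩
  · obtain ⟨s, hs⟩ := (hall ρ).2.1
    obtain ⟨x, hx, -⟩ := (X.mem_incoming _ _).1 hs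
    exact ⟨⟨(x, ρ), hx⟩⟩
  · exact Set.mem_of_eq_of_mem (hstar t) (hall t)

end STrees

/-! ### Trees whose edges display bipartitions of a set -/

section BranchTrees

open Classical in
/-- The nodes of a branch-decomposition of a set `E`, in terms of the sets displayed by the edges
towards the node: either a leaf, or three sets that partition `E`. -/
def branchNodes (E : Type*) : Set (Multiset (Set E)) :=
  {M | (∃ f, M = {{f}ᶜ}) ∨ (M.card = 3 ∧ ∀ f : E, M.countP (f ∈ ·) = 1)}

/-- The subsets of `E` that can be built from singletons by disjoint unions, using only
elements of `S`. -/
inductive Branched {E : Type*} (S : Set (Set E)) : Set E → Prop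
  | single {f : E} : {f} ∈ S → Branched S {f}
  | union {X Y : Set E} : Branched S X → Branched S Y → Disjoint X Y → X ∪ Y ∈ S →
      Branched S (X ∪ Y)

variable {E : Type*} {S : Set (Set E)}

theorem Branched.mem {X : Set E} (h : Branched S X) : X ∈ S := by
  cases h <;> assumption

/-- A singleton becomes a leaf, and a disjoint union a node at which the two parts and the
complement of their union partition `E`. The edge labelled by the complement is left open at the
root. -/
theorem Branched.exists_hasLTree (hS : ∀ X ∈ S, Xᶜ ∈ S) {X : Set E} (h : Branched S X) :
    ∃ M, HasLTree compl S (branchNodes E) M ∧ Xᶜ ::ₘ M ∈ branchNodes E := by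
  induction h with
  | @single f hf => exact ⟨0, .zero _, .inl ⟨f, rfl⟩⟩
  | @union X Y hX hY hd hXY ih1 ih2 =>
    obtain ⟨M, hM, hM'⟩ := ih1
    obtain ⟨N, hN, hN'⟩ := ih2
    refine ⟨X ::ₘ Y ::ₘ 0, ((HasLTree.zero _).join hN hY.mem (hS _ hY.mem) (compl_compl _)
      hN').join hM hX.mem (hS _ hX.mem) (compl_compl _) hM', .inr ⟨rfl, fun f => ?_⟩⟩
    have : f ∈ X → f ∉ Y := fun h => Set.disjoint_left.1 hd h
    rw [Multiset.countP_cons, Multiset.countP_cons, Multiset.countP_cons, Multiset.countP_zero]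
    by_cases h1 : f ∈ X <;> by_cases h2 : f ∈ Y <;> simp_all

/-- If all of `E` can be built from singletons, there is a labelled tree with a leaf for every
element. -/
theorem Branched.exists_lTree [Nontrivial E] (hS : ∀ X ∈ S, Xᶜ ∈ S)
    (h : Branched S Set.univ) :
    ∃ X : LTree (compl : Set E → Set E) S, ∀ t, X.incoming t ∈ branchNodes E := by
  generalize hU : Set.univ = U at h
  cases h with
  | @single f =>
    obtain ⟨g, hg⟩ := exists_ne f
    exact absurd (hU ▸ Set.mem_univ g : g ∈ {f}) hg
  | @union A B hA hB hd _ =>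
    obtain ⟨M, hM, hM'⟩ := hA.exists_hasLTree hS
    obtain ⟨N, hN, hN'⟩ := hB.exists_hasLTree hS
    -- The final union becomes an edge, not a node, which would have degree two: as the parts are
    -- complementary, the two roots can be joined directly.
    have hAB : Aᶜ = B := (IsCompl.of_eq (disjoint_iff.1 hd) hU.symm).compl_eq
    obtain ⟨X, ρ, hρ, hX⟩ := hM.join hN hB.mem (hS _ hB.mem) (compl_compl _) hN'
    refine ⟨X, fun t => ?_⟩
    by_cases ht : t = ρ
    · rw [ht, hρ, ← hAB]
      exact hM'
    · exact hX t ht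

variable {X : LTree (compl : Set E → Set E) S}

theorem LTree.disjoint_incoming (hX : ∀ t, X.incoming t ∈ branchNodes E) {t x y : X.Node}
    (hx : X.T.Adj x t) (hy : X.T.Adj y t) (hxy : x ≠ y) : Disjoint (X.α x t) (X.α y t) := by
  classical
  obtain ⟨M, hM⟩ := X.exists_incoming_eq hx hy hxy
  rcases hX t with ⟨f, hf⟩ | ⟨-, h⟩
  · have := congrArg Multiset.card (hM.symm.trans hf)
    simp at this
  · refine Set.disjoint_left.2 fun f h1 h2 => ?_
    have := h f
    simp [hM, h1, h2] at this

theorem LTree.exists_mem_incoming (hX : ∀ t, X.incoming t ∈ branchNodes E) {t : X.Node} {f : E}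
    (h : X.incoming t ≠ {{f}ᶜ}) : ∃ x, X.T.Adj x t ∧ f ∈ X.α x t := by
  classical
  have : ∃ A ∈ X.incoming t, f ∈ A := by
    rcases hX t with ⟨g, hg⟩ | ⟨-, h'⟩
    · refine ⟨{g}ᶜ, by simp [hg], fun hfg => h ?_⟩
      rw [hg, hfg]
    · exact Multiset.countP_pos.1 ((h' f).symm ▸ one_pos)
  obtain ⟨A, hA, hfA⟩ := this
  obtain ⟨x, hx, rfl⟩ := (X.mem_incoming _ _).1 hA
  exact ⟨x, hx, hfA⟩

/-- The leaf of `f` lies on the side of an edge whose label contains `f`. -/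
theorem LTree.mem_of_isPath (hX : ∀ t, X.incoming t ∈ branchNodes E) {f : E} {x t : X.Node}
    (p : X.T.Walk x t) (ht : X.incoming t = {{f}ᶜ}) (hp : p.IsPath) (y : X.Node)
    (hxy : X.T.Adj x y) (hy : y ∉ p.support) : f ∈ X.α x y := by
  have hflip : ∀ {x y : X.Node}, X.T.Adj x y → f ∉ X.α y x → f ∈ X.α x y := fun h h' => by
    rw [X.α_symm _ _ h] at h'
    exact not_not.1 h'
  induction p generalizing y with
  | nil =>
    refine hflip hxy fun h => ?_
    have : X.α y _ ∈ X.incoming _ := (X.mem_incoming _ _).2 ⟨y, hxy.symm, rfl⟩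
    rw [ht, Multiset.mem_singleton] at this
    exact (this ▸ h) rfl
  | @cons x x' t hxx' p ih =>
    rw [SimpleGraph.Walk.cons_isPath_iff] at hp
    rw [SimpleGraph.Walk.support_cons, List.mem_cons, not_or] at hy
    have h1 := ih ht hp.1 x hxx'.symm hp.2
    have hne : x' ≠ y := fun h => hy.2 (h ▸ p.start_mem_support)
    exact hflip hxy fun h =>
      Set.disjoint_left.1 (LTree.disjoint_incoming hX hxx'.symm hxy.symm hne) h1 h

theorem LTree.leaf_unique (hX : ∀ t, X.incoming t ∈ branchNodes E) {f : E} {s t : X.Node}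
    (hs : X.incoming s = {{f}ᶜ}) (ht : X.incoming t = {{f}ᶜ}) : s = t := by
  by_contra hst
  obtain ⟨p, hp⟩ := (X.isTree.connected.preconnected s t).exists_isPath
  cases p with
  | nil => exact hst rfl
  | @cons _ x _ hsx p =>
    rw [SimpleGraph.Walk.cons_isPath_iff] at hp
    have h1 := LTree.mem_of_isPath hX p ht hp.1 s hsx.symm hp.2
    have : X.α x s ∈ X.incoming s := (X.mem_incoming _ _).2 ⟨x, hsx.symm, rfl⟩
    rw [hs, Multiset.mem_singleton] at this
    exact (this ▸ h1) rfl

/-- Otherwise each node has an incoming label containing `f`. Some edge is then selected from both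
ends, yet its two labels are complementary. -/
theorem LTree.exists_leaf (hX : ∀ t, X.incoming t ∈ branchNodes E) (f : E) :
    ∃ t, X.incoming t = {{f}ᶜ} := by
  by_contra! hc
  choose g hg hfg using fun t => LTree.exists_mem_incoming hX (hc t)
  obtain ⟨t, ht⟩ := exists_flip_of_adj X.isTree g fun t => (hg t).symm
  have h1 := hfg (g t)
  rw [ht, X.α_symm _ _ (hg t)] at h1
  exact h1 (hfg t)

end BranchTrees

/-! ### From derivations to branch-decompositions -/

section BranchWidth

variable {V : Type*} {G : SimpleGraph V}

/-- The vertices incident with both an edge in `X` and an edge not in `X`. -/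
def boundary (X : Set G.edgeSet) : Set V :=
  {v | (∃ f ∈ X, v ∈ f.1) ∧ ∃ f ∈ Xᶜ, v ∈ f.1}

/-- The sets of edges with fewer than `k` vertices in their boundary. -/
def edgeSetsBelow (G : SimpleGraph V) (k : ℕ) : Set (Set G.edgeSet) :=
  {X | (boundary X).ncard < k}

theorem compl_mem_edgeSetsBelow {k : ℕ} {X : Set G.edgeSet} (h : X ∈ edgeSetsBelow G k) :
    Xᶜ ∈ edgeSetsBelow G k := by
  have : boundary Xᶜ = boundary X := by
    ext v
    simp only [boundary, compl_compl]
    exact and_comm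
  change _ < k
  rw [this]
  exact h

theorem BranchDecomposition.edgeOrder_le_width (X : BranchDecomposition G) (e : X.T.Dart) :
    X.edgeOrder e ≤ X.width := by
  have := X.finite_node
  have : Finite X.T.Dart := Finite.of_injective _ SimpleGraph.Dart.toProd_injective
  exact le_ciSup (Set.finite_range _).bddAbove e

/-- A tree of edge sets yields a branch-decomposition. -/
theorem Branched.exists_branchDecomposition [Finite V] {k : ℕ} (hk : 0 < k)
    (hE : 1 < G.edgeSet.ncard)
    (h : Branched (edgeSetsBelow G k) Set.univ) : ∃ X : BranchDecomposition G, X.width < k := by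
  have : Nontrivial G.edgeSet := by
    rw [Set.one_lt_ncard_iff_nontrivial] at hE
    exact hE.coe_sort
  classical
  obtain ⟨X, hX⟩ := h.exists_lTree fun _ => compl_mem_edgeSetsBelow
  choose L hL using LTree.exists_leaf hX
  have hleaf : ∀ f, (X.T.neighborSet (L f)).ncard = 1 := fun f => by
    rw [← X.card_incoming, hL, Multiset.card_singleton]
  let L' : G.edgeSet → {t : X.Node // (X.T.neighborSet t).ncard = 1} := fun f => ⟨L f, hleaf f⟩
  have hbij : Function.Bijective L' := by
    constructor
    · intro f g hfg
      have h1 : L f = L g := congrArg Subtype.val hfg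
      have h2 := hL f
      rw [h1, hL g] at h2
      simpa using h2.symm
    · rintro ⟨t, ht⟩
      rcases hX t with ⟨f, hf⟩ | ⟨h3, -⟩
      · exact ⟨f, Subtype.ext (LTree.leaf_unique hX (hL f) hf)⟩
      · rw [X.card_incoming, ht] at h3
        omega
  let Y : BranchDecomposition G :=
    { Node := X.Node
      finite_node := inferInstance
      T := X.T
      isTree := X.isTree
      ternary := fun t => by
        rw [← X.card_incoming]
        rcases hX t with ⟨f, hf⟩ | ⟨h3, -⟩
        · exact .inl (by rw [hf, Multiset.card_singleton])
        · exact .inr h3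
      L := Equiv.ofBijective L' hbij }
  have hside : ∀ (e : X.T.Dart) (f : G.edgeSet), L f ∈ Y.side e → f ∈ X.α e.fst e.snd := by
    rintro ⟨⟨x, y⟩, hxy⟩ f hf
    obtain ⟨p, hp⟩ := SimpleGraph.Reachable.exists_isPath
      (show (X.T.deleteEdges {s(x, y)}).Reachable x (L f) from hf)
    refine LTree.mem_of_isPath hX (p.mapLe (SimpleGraph.deleteEdges_le _)) (hL f)
      (hp.mapLe _) y hxy fun hy => ?_
    rw [SimpleGraph.Walk.support_mapLe_eq_support] at hy
    exact SimpleGraph.isAcyclic_iff_forall_adj_isBridge.1 X.isTree.isAcyclic hxy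
      (p.takeUntil y hy).reachable
  refine ⟨Y, ?_⟩
  suffices Y.width ≤ k - 1 by omega
  refine ciSup_le' fun e => ?_
  have h1 : (boundary (X.α e.fst e.snd)).ncard < k := X.α_mem _ _ e.adj
  refine (Set.ncard_le_ncard ?_ (Set.toFinite _)).trans (Nat.le_sub_one_of_lt h1)
  rintro v ⟨⟨f, hf, hf'⟩, ⟨g, hg, hg'⟩⟩
  refine ⟨⟨f, hside e f hf', hf⟩, ⟨g, ?_, hg⟩⟩
  rw [← X.α_symm _ _ e.adj]
  exact hside e.symm g hg'

/-- Adding elements one by one. -/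
theorem Branched.extend {E : Type*} [Finite E] {S : Set (Set E)} {A X : Set E}
    (hA : A = ∅ ∨ Branched S A) (hAX : A ⊆ X) (hS : ∀ Y, A ⊆ Y → Y ⊆ X → Y ∈ S)
    (h1 : ∀ f : E, {f} ∈ S) : X = ∅ ∨ Branched S X := by
  have key : ∀ D : Set E, A ∪ D ⊆ X → A ∪ D = ∅ ∨ Branched S (A ∪ D) := by
    intro D
    induction D, Set.toFinite D using Set.Finite.induction_on with
    | empty => simpa using fun _ => hA
    | @insert f D hf _ ih =>
      intro hD
      rw [Set.union_insert] at hD ⊢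
      have ih' := ih ((Set.subset_insert _ _).trans hD)
      by_cases hfA : f ∈ A ∪ D
      · rwa [Set.insert_eq_of_mem hfA]
      · right
        rcases ih' with h | h
        · rw [h, insert_empty_eq]
          exact .single (h1 f)
        · rw [Set.insert_eq]
          exact .union (.single (h1 f)) h (Set.disjoint_singleton_left.2 hfA)
            (hS _ (Set.subset_union_left.trans Set.subset_union_right) hD)
  have := key X (Set.union_subset hAX subset_rfl)
  rwa [Set.union_eq_self_of_subset_left hAX] at this

/-- With the bound `Nat.card V + 1` every edge set is allowed. Existence matters for lower bounds on
`branchWidth`, as `sInf ∅ = 0`. -/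
theorem exists_branchDecomposition [Finite V] (hE : 1 < G.edgeSet.ncard) :
    Nonempty (BranchDecomposition G) := by
  have hS : ∀ Y : Set G.edgeSet, Y ∈ edgeSetsBelow G (Nat.card V + 1) := fun Y => by
    have := Set.ncard_le_card (boundary Y)
    exact Nat.lt_succ_of_le this
  have hne : G.edgeSet.Nonempty := Set.nonempty_of_ncard_ne_zero (by omega)
  have := hne.coe_sort
  have h := (Branched.extend (S := edgeSetsBelow G (Nat.card V + 1)) (A := ∅) (X := Set.univ)
    (.inl rfl) (Set.empty_subset _) (fun Y _ _ => hS Y) fun f => hS _).resolve_left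
    Set.univ_nonempty.ne_empty
  exact (h.exists_branchDecomposition (Nat.succ_pos _) hE).nonempty

/-- A derivation of a separation `(A, B)` yields trees for the sets of edges between
`E(G[A]) \ E(G[B])` and `E(G[A])`. -/
theorem Der.branched [Finite V] {k : ℕ} (hk : 3 ≤ k) {r : VSep G} (h : Der k {VSep.least G} r)
    (hr : r ∈ sepsBelow G k) (X : Set G.edgeSet)
    (hX : ∀ f ∈ X, ∀ v ∈ f.1, v ∈ r.A)
    (hX' : ∀ f : G.edgeSet, f ∉ X → ∀ v ∈ f.1, v ∈ r.B) :
    X = ∅ ∨ Branched (edgeSetsBelow G k) X := by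
  -- A single edge has at most two boundary vertices, hence the assumption `3 ≤ k`.
  have hsingle : ∀ f : G.edgeSet, {f} ∈ edgeSetsBelow G k := by
    rintro ⟨f, hf⟩
    induction f with | _ u v
    refine lt_of_le_of_lt (Set.ncard_le_ncard (t := {u, v}) ?_ (Set.toFinite _))
      ((Set.ncard_insert_le u {v}).trans_lt (by rw [Set.ncard_singleton]; omega))
    rintro w ⟨⟨g, rfl, hw⟩, -⟩
    simpa using hw
  have hbelow : ∀ (r : VSep G) (X : Set G.edgeSet), r ∈ sepsBelow G k →
      (∀ f ∈ X, ∀ v ∈ f.1, v ∈ r.A) → (∀ f : G.edgeSet, f ∉ X → ∀ v ∈ f.1, v ∈ r.B) →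
      X ∈ edgeSetsBelow G k := by
    intro r X hr h1 h2
    refine lt_of_le_of_lt (Set.ncard_le_ncard ?_ (Set.toFinite _)) hr
    rintro v ⟨⟨f, hf, hv⟩, ⟨g, hg, hv'⟩⟩
    exact ⟨h1 f hf v hv, h2 g hg v hv'⟩
  induction h generalizing X with
  | base h =>
    obtain rfl := h
    left
    refine Set.eq_empty_of_forall_notMem fun f hf => ?_
    obtain ⟨⟨u, v⟩, hf'⟩ := f
    exact hX _ hf u (Sym2.mem_mk_left u v)
  | @step x y z hx hy hz h1 h2 h3 h4 _ _ ih1 ih2 =>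
    have hedge : ∀ (s : VSep G) (f : G.edgeSet),
        (∀ v ∈ f.1, v ∈ s.A) ∨ ∀ v ∈ f.1, v ∈ s.B := by
      rintro s ⟨⟨u, v⟩, hf⟩
      exact (s.adj_cases hf).imp
        (fun h w hw => by rcases Sym2.mem_iff.1 hw with rfl | rfl; exacts [h.1, h.2])
        (fun h w hw => by rcases Sym2.mem_iff.1 hw with rfl | rfl; exacts [h.1, h.2])
    let Y : Set G.edgeSet := {f | f ∈ X ∧ ∀ v ∈ f.1, v ∈ y.A}
    -- Edges inside both `y.A` and `z.A` are counted in `Y` only, to keep the union disjoint.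
    let Z : Set G.edgeSet := {f | f ∈ X ∧ (∀ v ∈ f.1, v ∈ z.A) ∧ f ∉ Y}
    have hY : Y = ∅ ∨ Branched (edgeSetsBelow G k) Y := by
      refine ih1 hy Y (fun f hf => hf.2) fun f hf v hv => ?_
      by_cases hfX : f ∈ X
      · exact (hedge y f).resolve_left (fun h => hf ⟨hfX, h⟩) v hv
      · exact h1.2 (hX' f hfX v hv)
    have hZ : Z = ∅ ∨ Branched (edgeSetsBelow G k) Z := by
      refine ih2 hz Z (fun f hf => hf.2.1) fun f hf v hv => ?_
      by_cases hfX : f ∈ X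
      · by_cases hfY : f ∈ Y
        · exact h3.1 (hfY.2 v hv)
        · exact (hedge z f).resolve_left (fun h => hf ⟨hfX, h, hfY⟩) v hv
      · exact h2.2 (hX' f hfX v hv)
    have hrest : ∀ f : G.edgeSet, f ∉ Y ∪ Z → ∀ v ∈ f.1, v ∈ x.A := by
      intro f hf
      by_cases hfX : f ∈ X
      · obtain ⟨⟨u, v⟩, hf'⟩ := f
        have hall : ∀ s : VSep G, u ∈ s.A ∧ v ∈ s.A → ∀ w ∈ s(u, v), w ∈ s.A := by
          rintro s ⟨h, h'⟩ w hw
          rcases Sym2.mem_iff.1 hw with rfl | rfl <;> assumption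
        rcases h4.2 u v hf' with h | h | h
        · exact hall x h
        · exact absurd (.inl ⟨hfX, hall y h⟩) hf
        · by_cases hfY : ⟨s(u, v), hf'⟩ ∈ Y
          · exact absurd (.inl hfY) hf
          · exact absurd (.inr ⟨hfX, hall z h, hfY⟩) hf
      · exact hX' f hfX
    have hYZX : Y ∪ Z ⊆ X := Set.union_subset (fun f hf => hf.1) (fun f hf => hf.1)
    -- All edges outside `Y ∪ Z` lie in `x.A`, so the rest of `X` can be added edge by edge while
    -- the boundary stays inside `x.A ∩ x.B`.
    have hS : ∀ W, Y ∪ Z ⊆ W → W ⊆ X → W ∈ edgeSetsBelow G k := fun W hW hW' =>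
      hbelow x.flip W hr (fun f hf => hX f (hW' hf)) fun f hf => hrest f fun h => hf (hW h)
    refine Branched.extend ?_ hYZX hS hsingle
    rcases hY with hY | hY
    · rw [hY, Set.empty_union]
      exact hZ
    · rcases hZ with hZ | hZ
      · rw [hZ, Set.union_empty]
        exact .inr hY
      · exact .inr (.union hY hZ (Set.disjoint_left.2 fun f hf hf' => hf'.2.2 hf)
          (hS _ subset_rfl hYZX))

/-- If the greatest separation is derivable, the graph has small branch-width. -/
theorem Der.branchWidth_lt [Finite V] {k : ℕ} (hk : 3 ≤ k)
    (h : Der k {VSep.least G} (VSep.least G).flip) : branchWidth G < k := by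
  unfold branchWidth
  split_ifs with hE
  · omega
  · have hE' : 1 < G.edgeSet.ncard := not_le.1 hE
    have hne : G.edgeSet.Nonempty := Set.nonempty_of_ncard_ne_zero (by omega)
    have := hne.coe_sort
    have h1 := (h.branched hk (VSep.flip_mem_sepsBelow.2 (VSep.least_mem (by omega))) Set.univ
      (fun _ _ _ _ => trivial) (fun f hf => absurd trivial hf)).resolve_left
      Set.univ_nonempty.ne_empty
    obtain ⟨X, hX⟩ := h1.exists_branchDecomposition (by omega) hE'
    exact (Nat.sInf_le (Set.mem_range_self X)).trans_lt hX

end BranchWidth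

/-! ### Tangles of order at least three bound the branch-width -/

section TangleToBranchWidth

variable {V : Type*} {G : SimpleGraph V} {k : ℕ} {O : Set (VSep G)}

/-- The separation `(A, V)`. -/
def VSep.small (G : SimpleGraph V) (A : Set V) : VSep G :=
  VSep.mk' A Set.univ (fun _ => .inr trivial) (fun _ _ _ => .inr ⟨trivial, trivial⟩)

theorem VSep.order_small (A : Set V) : (VSep.small G A).order = A.ncard := by
  simp [VSep.order, VSep.small, VSep.mk']

theorem IsTangle.small_mem (h : IsTangle G k O) {A : Set V} (hA : A.ncard < k) :
    VSep.small G A ∈ O := by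
  have hs : VSep.small G A ∈ sepsBelow G k := by
    change _ < k
    rwa [VSep.order_small]
  refine (h.mem_or hs).resolve_right fun h' => h.not_covers h' h' h' ?_
  exact ⟨fun _ => .inl trivial, fun _ _ _ => .inl ⟨trivial, trivial⟩⟩

/-- No three separations in a tangle of order at least two have first sides whose induced
subgraphs contain all edges. -/
theorem IsTangle.not_covers_edges [Finite V] (h : IsTangle G k O) (hk : 2 ≤ k) {r s t : VSep G}
    (hr : r ∈ O) (hs : s ∈ O) (ht : t ∈ O) :
    ¬ ∀ u v, G.Adj u v → (u ∈ r.A ∧ v ∈ r.A) ∨ (u ∈ s.A ∧ v ∈ s.A) ∨ (u ∈ t.A ∧ v ∈ t.A) := by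
  intro hcov
  -- Isolated vertices form the first side of a separation in the tangle.
  have key : ∀ W : Set V, (∀ w ∈ W, ∀ v, ¬ G.Adj w v) → ∃ q ∈ O, q.A = W ∧ q.B = Wᶜ := by
    intro W
    induction W, Set.toFinite W using Set.Finite.induction_on with
    | empty => exact fun _ => ⟨VSep.small G ∅, h.small_mem (by simp; omega), rfl, by simp; rfl⟩
    | @insert w W hw _ ih =>
      intro hiso
      obtain ⟨q, hq, hqA, hqB⟩ := ih fun w hw => hiso w (.inr hw)
      have hadj : ∀ u v, G.Adj u v → u ∉ insert w W ∧ v ∉ insert w W := fun u v huv =>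
        ⟨fun hu => hiso u hu v huv, fun hv => hiso v hv u huv.symm⟩
      let p : VSep G := VSep.mk' (insert w W) (insert w W)ᶜ (fun v => em _)
        (fun u v huv => .inr (hadj u v huv))
      have hp : p ∈ sepsBelow G k := by
        change (insert w W ∩ (insert w W)ᶜ).ncard < k
        rw [Set.inter_compl_self, Set.ncard_empty]
        omega
      refine ⟨p, (h.mem_or hp).resolve_right fun hp' => ?_, rfl, rfl⟩
      -- The separation ({w}, V) has order one, which requires `2 ≤ k`.
      refine h.not_covers hp' hq (h.small_mem (A := {w}) (by simp; omega))
        ⟨fun v => ?_, fun u v huv => .inl (hadj u v huv)⟩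
      rw [hqA]
      by_cases hv : v ∈ insert w W
      · exact hv.elim (fun h => .inr (.inr h)) fun h => .inr (.inl h)
      · exact .inl hv
  obtain ⟨q, hq, hqA, hqB⟩ := key {v | ¬ (v ∈ r.A ∨ v ∈ s.A ∨ v ∈ t.A)} (by
    intro w hw v hwv
    have := hcov w v hwv
    simp only [Set.mem_ofPred_eq] at hw
    tauto)
  have hW : ∀ v, v ∈ q.A → ¬ (v ∈ r.A ∨ v ∈ s.A ∨ v ∈ t.A) := fun v hv => by rwa [hqA] at hv
  have hW' : ∀ v, v ∈ r.A ∨ v ∈ s.A ∨ v ∈ t.A → v ∈ q.B := fun v hv =>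
    (q.mem_or v).resolve_left fun h => hW v h hv
  -- Adding the uncovered vertices, which are all isolated, to the first side of `r` does not
  -- enlarge its separator.
  have hj : r.join q ∈ sepsBelow G k := by
    refine lt_of_le_of_lt (Set.ncard_le_ncard ?_ (Set.toFinite _)) (h.subset hr)
    rintro v ⟨h1 | h1, h2, h3⟩
    · exact ⟨h1, h2⟩
    · change v ∈ q.B at h3
      rw [hqB, ← hqA] at h3
      exact absurd h1 h3
  have hjO : r.join q ∈ O := by
    refine (h.mem_or hj).resolve_right fun h' => h.not_covers h' hr hq
      ⟨fun v => ?_, fun u v huv => ?_⟩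
    · exact ((r.join q).mem_or v).symm.imp id fun h => h
    · rcases r.adj_cases huv with h1 | h1
      · exact .inr (.inl h1)
      · have hu := hcov u v huv
        exact .inl ⟨⟨h1.1, hW' u (by tauto)⟩, ⟨h1.2, hW' v (by tauto)⟩⟩
  refine h.not_covers hjO hs ht ⟨fun v => ?_, fun u v huv => ?_⟩
  · by_cases hv : v ∈ r.A ∨ v ∈ s.A ∨ v ∈ t.A
    · exact hv.imp .inl id
    · refine .inl (.inr ?_)
      change v ∈ q.A
      rw [hqA]
      exact hv
  · exact (hcov u v huv).imp (fun h => ⟨.inl h.1, .inl h.2⟩) id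

theorem IsTangle.edgeSet_nonempty [Finite V] {O : Set (VSep G)} (h : IsTangle G k O)
    (hk : 2 ≤ k) : G.edgeSet.Nonempty := by
  refine Set.nonempty_iff_ne_empty.2 fun h0 => ?_
  have h1 := h.small_mem (A := ∅) (by simp; omega)
  refine h.not_covers_edges hk h1 h1 h1 fun u v huv => ?_
  exact absurd (h0 ▸ huv : s(u, v) ∈ (∅ : Set (Sym2 V))) (Set.notMem_empty _)

theorem exists_path_from {N : Type*} {T : SimpleGraph N} (hT : T.Connected) {t l : N} (h : l ≠ t) :
    ∃ u, T.Adj t u ∧ ∃ p : T.Walk u l, t ∉ p.support := by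
  obtain ⟨p, hp⟩ := (hT.preconnected t l).exists_isPath
  cases p with
  | nil => exact absurd rfl h
  | @cons _ u _ htu p => exact ⟨u, htu, p, ((SimpleGraph.Walk.cons_isPath_iff _ _).1 hp).2⟩

theorem BranchDecomposition.exists_mem_side (X : BranchDecomposition G) {t l : X.Node}
    (h : l ≠ t) : ∃ u, ∃ hu : X.T.Adj u t, l ∈ X.side ⟨(u, t), hu⟩ := by
  obtain ⟨u, htu, p, hp⟩ := exists_path_from X.isTree.connected h
  refine ⟨u, htu.symm, ⟨p.toDeleteEdges _ ?_⟩⟩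
  rintro e he rfl
  exact hp (p.snd_mem_support_of_mem_edges he)

theorem BranchDecomposition.mem_side_or (X : BranchDecomposition G) (e : X.T.Dart) (l : X.Node) :
    l ∈ X.side e ∨ l ∈ X.side e.symm := by
  by_cases hl : l = e.snd
  · right
    rw [hl]
    exact SimpleGraph.Reachable.refl _
  · obtain ⟨⟨x, y⟩, hxy⟩ := e
    obtain ⟨u, hyu, p, hp⟩ := exists_path_from X.isTree.connected hl
    have hedge : s(x, y) ∉ p.edges := fun he => hp (p.snd_mem_support_of_mem_edges he)
    by_cases hu : u = x
    · subst hu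
      left
      exact ⟨p.toDeleteEdges _ (by rintro e he rfl; exact hedge he)⟩
    · right
      have he : (SimpleGraph.Dart.symm ⟨(x, y), hxy⟩ : X.T.Dart).edge = s(x, y) := Sym2.eq_swap
      change (X.T.deleteEdges {(SimpleGraph.Dart.symm ⟨(x, y), hxy⟩ : X.T.Dart).edge}).Reachable y l
      rw [he]
      refine ⟨(SimpleGraph.Walk.cons hyu p).toDeleteEdges _ ?_⟩
      rintro e he rfl
      rw [SimpleGraph.Walk.edges_cons, List.mem_cons] at he
      rcases he with he | he
      · rcases Sym2.eq_iff.1 he with ⟨h1, h2⟩ | ⟨h1, h2⟩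
        · exact hxy.ne h1
        · exact hu h1.symm
      · exact hedge he

/-- The separation of `G` displayed by an edge of a branch-decomposition; isolated vertices are put
on the second side. -/
def BranchDecomposition.sep (X : BranchDecomposition G) (e : X.T.Dart) : VSep G :=
  VSep.mk' (X.sideVerts e) (X.sideVerts e.symm ∪ {v | ∀ w, ¬ G.Adj v w})
    (fun v => by
      by_cases hv : ∃ w, G.Adj v w
      · obtain ⟨w, hw⟩ := hv
        exact (X.mem_side_or e (X.L ⟨s(v, w), hw⟩)).imp
          (fun h => ⟨_, Sym2.mem_mk_left v w, h⟩) fun h => .inl ⟨_, Sym2.mem_mk_left v w, h⟩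
      · exact .inr (.inr (not_exists.1 hv)))
    (fun v w hw => (X.mem_side_or e (X.L ⟨s(v, w), hw⟩)).imp
      (fun h => ⟨⟨_, Sym2.mem_mk_left v w, h⟩, ⟨_, Sym2.mem_mk_right v w, h⟩⟩)
      fun h => ⟨.inl ⟨_, Sym2.mem_mk_left v w, h⟩, .inl ⟨_, Sym2.mem_mk_right v w, h⟩⟩)

theorem BranchDecomposition.order_sep_le [Finite V] (X : BranchDecomposition G) (e : X.T.Dart) :
    (X.sep e).order ≤ X.width := by
  refine (Set.ncard_le_ncard ?_ (Set.toFinite _)).trans (X.edgeOrder_le_width e)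
  rintro v ⟨h1, h2 | h2⟩
  · exact ⟨h1, h2⟩
  · obtain ⟨⟨f, hf⟩, hv, -⟩ := h1
    obtain ⟨w, rfl⟩ := hv
    exact absurd hf (h2 w)

/-- `X.sep e.symm` need not be the inverse of `X.sep e`, as both put isolated vertices on the second
side; it lies below that inverse, so down-closure suffices. -/
theorem IsTangle.sep_mem_or [Finite V] (h : IsTangle G k O) (X : BranchDecomposition G)
    (hX : X.width < k) (e : X.T.Dart) : X.sep e ∈ O ∨ X.sep e.symm ∈ O :=
  (h.mem_or ((X.order_sep_le e).trans_lt hX)).imp id fun h' =>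
    h.mem_of_le h' ((X.order_sep_le e.symm).trans_lt hX)
      ⟨Set.subset_union_left, fun _ hv => .inl hv⟩

/-- A tangle of order at least three bounds the branch-width from below. -/
theorem IsTangle.le_branchWidth [Finite V] (h : IsTangle G k O) (hk : 3 ≤ k) :
    k ≤ branchWidth G := by
  have hone : ∀ u v, VSep.small G {u, v} ∈ O := fun u v =>
    h.small_mem ((Set.ncard_insert_le u {v}).trans_lt (by rw [Set.ncard_singleton]; omega))
  have hpair : ∀ {u v a b : V}, s(a, b) = s(u, v) →
      a ∈ (VSep.small G {u, v}).A ∧ b ∈ (VSep.small G {u, v}).A := by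
    intro u v a b hab
    rcases Sym2.eq_iff.1 hab with ⟨rfl, rfl⟩ | ⟨rfl, rfl⟩
    · exact ⟨.inl rfl, .inr rfl⟩
    · exact ⟨.inr rfl, .inl rfl⟩
  unfold branchWidth
  split_ifs with hE
  · exfalso
    rw [Set.ncard_le_one (Set.toFinite _)] at hE
    rcases G.edgeSet.eq_empty_or_nonempty with h0 | ⟨⟨u, v⟩, hf⟩
    · exact (h.edgeSet_nonempty (by omega)).ne_empty h0
    · exact h.not_covers_edges (by omega) (hone u v) (hone u v) (hone u v) fun a b hab =>
        .inl (hpair (hE _ hab _ hf))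
  · by_contra! hlt
    obtain ⟨X, hX⟩ := Nat.sInf_mem
      ((Set.range_nonempty_iff_nonempty (f := (BranchDecomposition.width (G := G)))).2
        (exists_branchDecomposition (not_le.1 hE)))
    rw [← hX] at hlt
    have := X.finite_node
    have hside : ∀ (e : X.T.Dart) (u v : V) (huv : G.Adj u v), (X.L ⟨s(u, v), huv⟩).1 ∈ X.side e →
        u ∈ (X.sep e).A ∧ v ∈ (X.sep e).A := fun e u v huv h =>
      ⟨⟨_, Sym2.mem_mk_left u v, h⟩, ⟨_, Sym2.mem_mk_right u v, h⟩⟩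
    -- If all incoming separations at a node were in `O`, their first sides would contain all edges,
    -- except at a leaf the edge mapped there; the separation ({u, v}, V) of order two, available as
    -- `3 ≤ k`, takes care of that edge.
    have hex : ∀ t, ∃ u, ∃ hu : X.T.Adj u t, X.sep ⟨(u, t), hu⟩ ∉ O := by
      intro t
      by_contra! hc
      rcases X.ternary t with ht | ht
      · obtain ⟨x, hx⟩ := Set.ncard_eq_one.1 ht
        have hxt : X.T.Adj x t := SimpleGraph.Adj.symm (hx ▸ rfl : x ∈ X.T.neighborSet t)
        obtain ⟨⟨⟨u, v⟩, hf⟩, hft⟩ := X.L.surjective ⟨t, ht⟩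
        refine h.not_covers_edges (by omega) (hone u v) (hc x hxt) (hc x hxt) fun a b hab => ?_
        by_cases hl : (X.L ⟨s(a, b), hab⟩).1 = t
        · left
          have : X.L ⟨s(a, b), hab⟩ = X.L ⟨s(u, v), hf⟩ := (Subtype.ext hl).trans hft.symm
          exact hpair (congrArg Subtype.val (X.L.injective this))
        · right; left
          obtain ⟨y, hy, hyl⟩ := X.exists_mem_side hl
          obtain rfl : y = x := by
            have : y ∈ X.T.neighborSet t := hy.symm
            rwa [hx] at this
          exact hside _ a b hab hyl
      · obtain ⟨x, y, z, -, -, -, hxyz⟩ := Set.ncard_eq_three.1 ht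
        have hadj : ∀ w, w ∈ ({x, y, z} : Set X.Node) → X.T.Adj w t := fun w hw => by
          rw [← hxyz] at hw
          exact SimpleGraph.Adj.symm hw
        have hx := hadj x (by simp)
        have hy := hadj y (by simp)
        have hz := hadj z (by simp)
        refine h.not_covers_edges (by omega) (hc x hx) (hc y hy) (hc z hz) fun a b hab => ?_
        have hl : (X.L ⟨s(a, b), hab⟩).1 ≠ t := fun h' => by
          have := (X.L ⟨s(a, b), hab⟩).2
          rw [h', ht] at this
          omega
        obtain ⟨w, hw, hwl⟩ := X.exists_mem_side hl
        have hw' : w ∈ ({x, y, z} : Set X.Node) := hxyz ▸ hw.symm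
        rcases hw' with rfl | rfl | rfl
        · exact .inl (hside _ a b hab hwl)
        · exact .inr (.inl (hside _ a b hab hwl))
        · exact .inr (.inr (hside _ a b hab hwl))
    choose f hf hfO using hex
    obtain ⟨t, ht⟩ := exists_flip_of_adj X.isTree f fun t => (hf t).symm
    have h1 := hfO t
    have h2 := hfO (f t)
    simp only [ht] at h2
    exact (h.sep_mem_or X hlt ⟨(f t, t), hf t⟩).elim h1 h2

end TangleToBranchWidth

/-! ### Orders one and two, and star forests -/

section SmallOrder

variable {V : Type*} {G : SimpleGraph V} {k : ℕ}

/-- A set of at least `k` vertices that cannot be separated, such as a vertex or an edge, defines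
a tangle of order `k`. -/
theorem isTangle_of_forall_subset [Finite V] {W : Set V} (hk : k ≤ W.ncard)
    (hW : ∀ s : VSep G, W ⊆ s.A ∨ W ⊆ s.B)
    (hW' : ∀ r s t : VSep G, Covers r s t → W ⊆ r.A ∨ W ⊆ s.A ∨ W ⊆ t.A) :
    IsTangle G k {s | s ∈ sepsBelow G k ∧ W ⊆ s.B} := by
  have hnot : ∀ s ∈ sepsBelow G k, W ⊆ s.B → ¬ W ⊆ s.A := fun s (hs : _ < k) h h' => by
    have := Set.ncard_le_ncard (Set.subset_inter h' h) (Set.toFinite _)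
    change (s.A ∩ s.B).ncard < k at hs
    omega
  refine ⟨isOrientation_iff.2 ⟨fun s hs => hs.1, fun s hs => ⟨?_, ?_⟩⟩, avoids_tangleF_of ?_⟩
  · exact (hW s).symm.imp (fun h => ⟨hs, h⟩) fun h => ⟨VSep.flip_mem_sepsBelow.2 hs, h⟩
  · exact fun h h' => absurd h'.2 (hnot s hs h.2)
  · intro r hr s hs t ht hc
    rcases hW' r s t hc with h | h | h
    · exact hnot r hr.1 hr.2 h
    · exact hnot s hs.1 hs.2 h
    · exact hnot t ht.1 ht.2 h

theorem exists_isTangle_one [Finite V] [Nonempty V] : ∃ O, IsTangle G 1 O := by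
  obtain ⟨w⟩ := ‹Nonempty V›
  refine ⟨_, isTangle_of_forall_subset (W := {w}) (by simp) (fun s => ?_) fun r s t h => ?_⟩
  · simpa using s.mem_or w
  · simpa using h.1 w

theorem exists_isTangle_two [Finite V] (h : G.edgeSet.Nonempty) : ∃ O, IsTangle G 2 O := by
  obtain ⟨⟨u, v⟩, huv⟩ := h
  refine ⟨_, isTangle_of_forall_subset (W := {u, v}) ?_ (fun s => ?_) fun r s t h => ?_⟩
  · rw [Set.ncard_pair (G.ne_of_adj huv)]
  · simpa [Set.insert_subset_iff] using s.adj_cases huv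
  · simpa [Set.insert_subset_iff] using h.2 u v huv

/-- A graph that is not a disjoint union of stars has an edge whose ends both have another
neighbour. -/
theorem exists_inner_edge_of_not_isStarForest (h : ¬ IsStarForest G) :
    ∃ u v, G.Adj u v ∧ (∃ w, G.Adj u w ∧ w ≠ v) ∧ ∃ w, G.Adj v w ∧ w ≠ u := by
  by_contra! hc
  refine h fun C => ?_
  -- The centre is a vertex with two neighbours if the component has one; otherwise no vertex has
  -- more than one neighbour and any choice works.
  obtain ⟨c, hcC, hcen⟩ : ∃ c ∈ C.supp, (∀ x, (∀ y, G.Adj c y → y = x) →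
      ∀ y ∈ C.supp, ∀ z, G.Adj y z → ∀ z', G.Adj y z' → z = z') := by
    by_cases hex : ∃ c ∈ C.supp, ∃ z, G.Adj c z ∧ ∃ z', G.Adj c z' ∧ z ≠ z'
    · obtain ⟨c, hcC, z, hz, z', hz', hne⟩ := hex
      exact ⟨c, hcC, fun x hx => absurd ((hx z hz).trans (hx z' hz').symm) hne⟩
    · obtain ⟨c, hcC⟩ := C.nonempty_supp
      refine ⟨c, hcC, fun x _ y hy z hz z' hz' => by_contra fun hne => hex ?_⟩
      exact ⟨y, hy, z, hz, z', hz', hne⟩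
  have hsupp : ∀ {x y : V}, G.Adj x y → x ∈ C.supp → y ∈ C.supp := fun hxy hx =>
    (C.mem_supp_congr_adj hxy).1 hx
  have hback : ∀ x y, G.Adj c x → G.Adj x y → y = c := by
    intro x y hcx hxy
    by_cases hone : ∃ w, G.Adj c w ∧ w ≠ x
    · exact hc c x hcx hone y hxy
    · push Not at hone
      exact hcen x hone x (hsupp hcx hcC) y hxy c hcx.symm
  have hnear : ∀ x ∈ C.supp, x = c ∨ G.Adj c x := by
    intro x hx
    have hreach : G.Reachable c x :=
      SimpleGraph.ConnectedComponent.exact (hcC.trans hx.symm)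
    obtain ⟨p⟩ := hreach.symm
    clear hreach
    have := hx
    induction p with
    | nil => exact .inl rfl
    | @cons x y z hxy p ih =>
      rcases ih hcC hcen hback (hsupp hxy hx) (hsupp hxy hx) with rfl | h
      · exact .inr hxy.symm
      · exact .inl (hback y x h hxy.symm)
  refine ⟨⟨c, hcC⟩, ?_⟩
  ext ⟨a, ha⟩ ⟨b, hb⟩
  rw [SimpleGraph.starGraph_adj]
  change G.Adj a b ↔ _
  simp only [ne_eq, Subtype.mk.injEq]
  constructor
  · intro hab
    exact ⟨hab.ne, (hnear a ha).imp id fun hca => hback a b hca hab⟩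
  · rintro ⟨hab, rfl | rfl⟩
    · exact (hnear b hb).resolve_left (Ne.symm hab)
    · exact ((hnear a ha).resolve_left hab).symm

/-- Both ends of an inner edge meet further edges, so in any branch-decomposition the tree edge at
the leaf of that inner edge has order at least two. -/
theorem two_le_branchWidth [Finite V] (h : ¬ IsStarForest G) : 2 ≤ branchWidth G := by
  obtain ⟨u, v, huv, ⟨w, hw, hwv⟩, ⟨w', hw', hwu⟩⟩ := exists_inner_edge_of_not_isStarForest h
  have hne : ∀ {a b c : V}, b ≠ c → s(a, b) ≠ s(a, c) := fun h h' =>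
    h (Sym2.congr_right.1 h')
  have hne' : s(v, w') ≠ s(u, v) := by
    rw [Sym2.eq_swap (a := u)]
    exact hne hwu
  have hE : 1 < G.edgeSet.ncard :=
    (Set.one_lt_ncard (Set.toFinite _)).2 ⟨s(u, w), hw, s(u, v), huv, hne hwv⟩
  unfold branchWidth
  rw [if_neg (not_le.2 hE)]
  have := exists_branchDecomposition hE
  refine le_csInf (Set.range_nonempty _) ?_
  rintro _ ⟨X, rfl⟩
  obtain ⟨x, hx⟩ := Set.ncard_eq_one.1 (X.L ⟨s(u, v), huv⟩).2
  have htx : X.T.Adj (X.L ⟨s(u, v), huv⟩).1 x := (hx ▸ rfl : x ∈ X.T.neighborSet _)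
  have hopp : ∀ f : G.edgeSet, f.1 ≠ s(u, v) → (X.L f).1 ∈ X.side ⟨(x, _), htx.symm⟩ := by
    intro f hf
    obtain ⟨y, hy, hyl⟩ := X.exists_mem_side (t := (X.L ⟨s(u, v), huv⟩).1) (l := (X.L f).1)
      fun h => hf (congrArg Subtype.val (X.L.injective (Subtype.ext h)))
    obtain rfl : y = x := by
      have : y ∈ X.T.neighborSet (X.L ⟨s(u, v), huv⟩).1 := hy.symm
      rwa [hx] at this
    exact hyl
  refine le_trans ?_ (X.edgeOrder_le_width ⟨(_, x), htx⟩)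
  rw [← Set.ncard_pair huv.ne]
  refine Set.ncard_le_ncard ?_ (Set.toFinite _)
  rintro z (rfl | rfl)
  · exact ⟨⟨_, Sym2.mem_mk_left _ _, SimpleGraph.Reachable.refl _⟩,
      ⟨⟨_, hw⟩, Sym2.mem_mk_left _ _, hopp ⟨_, hw⟩ (hne hwv)⟩⟩
  · exact ⟨⟨_, Sym2.mem_mk_right _ _, SimpleGraph.Reachable.refl _⟩,
      ⟨⟨_, hw'⟩, Sym2.mem_mk_left _ _, hopp ⟨_, hw'⟩ hne'⟩⟩

theorem edgeSet_nonempty_of_branchWidth_pos (h : 0 < branchWidth G) : G.edgeSet.Nonempty := by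
  refine Set.nonempty_iff_ne_empty.2 fun h0 => ?_
  simp [branchWidth, h0] at h

end SmallOrder

end TangleDuality

theorem mainTheorem4 {V : Type*} [Finite V] [Nonempty V] (G : SimpleGraph V) (k : ℕ) (hk : 0 < k) :
    List.TFAE [
      ∃ O, TangleDuality.IsTangle G k O,
      ∃ O, TangleDuality.IsFTangle (TangleDuality.sepsBelow G k) (TangleDuality.tangleF G k) O,
      ∃ O, TangleDuality.IsFTangle (TangleDuality.sepsBelow G k) (TangleDuality.tangleFStar G k) O,
      ¬ ∃ X : TangleDuality.STree (TangleDuality.sepsBelow G k),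
        X.IsOver (TangleDuality.tangleFStar G k),
      k ≤ TangleDuality.branchWidth G ∨
        (k ≤ 2 ∧ TangleDuality.IsStarForest G ∧ G.edgeSet.Nonempty) ∨
        (k = 1 ∧ G.edgeSet = ∅)] := by
  tfae_have 1 → 2 := fun ⟨O, hO⟩ => ⟨O, hO.isFTangle⟩
  tfae_have 2 → 3 := fun ⟨O, hO⟩ =>
    ⟨O, hO.orientation, hO.consistent, fun σ hσ => hO.avoids σ hσ.1⟩
  tfae_have 3 → 4 := fun ⟨O, hO⟩ => TangleDuality.not_exists_isOver_of_isFTangle hO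
  tfae_have 4 → 1 := fun h => by_contra fun hO =>
    h ((TangleDuality.der_of_forall_not_isTangle hk hO).exists_isOver hk)
  tfae_have 1 → 5 := by
    rintro ⟨O, hO⟩
    rcases le_or_gt 3 k with h3 | h3
    · exact .inl (hO.le_branchWidth h3)
    · by_cases hS : TangleDuality.IsStarForest G
      · rcases G.edgeSet.eq_empty_or_nonempty with h0 | h0
        · refine .inr (.inr ⟨?_, h0⟩)
          by_contra hk1
          exact (hO.edgeSet_nonempty (by omega)).ne_empty h0
        · exact .inr (.inl ⟨by omega, hS, h0⟩)
      · exact .inl ((by omega : k ≤ 2).trans (TangleDuality.two_le_branchWidth hS))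
  tfae_have 5 → 1 := by
    intro h
    rcases le_or_gt 3 k with h3 | h3
    · by_contra hO
      have := (TangleDuality.der_of_forall_not_isTangle hk hO).branchWidth_lt h3
      rcases h with h | h | h <;> omega
    · obtain rfl | rfl : k = 1 ∨ k = 2 := by omega
      · exact TangleDuality.exists_isTangle_one
      · refine TangleDuality.exists_isTangle_two ?_
        rcases h with h | h | h
        · exact TangleDuality.edgeSet_nonempty_of_branchWidth_pos (by omega)
        · exact h.2.2
        · omega
  tfae_finish
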